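/- **Definitions.** For a nonempty finite set $A\subset\mathbb R$ put $\delta_A=\frac1{\#A}\sum_{a\in A}\delta_a$, where $\delta_a$ is the Dirac mass at $a$. A Borel probability measure $\mu$ on $\mathbb R$ is *spectral* if there is a countable set $\Lambda\subset\mathbb R$ such that $\{e^{2\pi i\lambda x}:\lambda\in\Lambda\}$ is an orthonormal basis of $L^2(\mu)$. For an integer $N\ge 2$ and finite nonempty sets $B,L\subset\mathbb Z$ with $\#B=\#L=M\le N$, $(N,B,L)$ is a *Hadamard triple* if the matrix $\frac1{\sqrt M}\left[e^{-2\pi i bl/N}\right]_{b\in B,\,l\in L}$ is unitary. Given integers $N_n\ge2$ and nonempty sets $B_n\subset\{0,1,\dots,N_n-1\}$ ($n\ge1$), the *Cantor–Moran measure* is the infinite convolution $$\mu(N_n,B_n)=\delta_{\frac1{N_1}B_1}*\delta_{\frac1{N_1N_2}B_2}*\delta_{\frac1{N_1N_2N_3}B_3}*\cdots .$$ Let $\mu_{>n}$ be the convolution of all of these factors except the first $n$, let $\nu_{>n}(E)=\mu_{>n}\big((N_1\cdots N_n)^{-1}E\big)$ for Borel sets $E$, and let $\rho=\frac12(\delta_0+\delta_1)$.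 For $0<\delta<\frac13$ let $$B_{n,\delta}=\{b\in B_n: b/N_n\notin(\delta,1-\delta)\},\quad B_{n,\delta,0}=B_{n,\delta}\cap[0,N_n\delta],\quad B_{n,\delta,1}=N_n-\big(B_{n,\delta}\cap[N_n(1-\delta),N_n)\big).$$ $(N_n,B_n)$ is *symmetric* if for every sufficiently small $\delta>0$ there is $n_0$ such that for all $n\ge n_0$, $B_n=B_{n,\delta}$ and $B_{n,\delta,1}=B_{n,\delta,0}\setminus\{0\}$. The *sum of sine problem holds* for a collection $\mathcal B$ of finite sets of positive integers if there are $\epsilon_0>0$ and $\delta_0>0$ such that for all $B\in\mathcal B$, $$\max_{x\in[0,\frac12-\delta_0]}\Big|\sum_{b\in B}\sin(2\pi bx)\Big|\ge\epsilon_0\,\#B .$$ **Theorem 1.6.** Let $\{(N_n,B_n,L_n)\}_{n\ge1}$ be a sequence of Hadamard triples with $B_n\subset\{0,1,\dots,N_n-1\}$ for all $n$. Suppose that $\nu_{>n}$ converges weakly to $\rho$, that $\lim_{n\to\infty}\#B_n=\infty$, that $(N_n,B_n)$ is symmetric, and that for some $\delta\in(0,\frac13)$ and some subsequence $\{n_j\}$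 the sum of sine problem holds for $\mathcal B=\{B_{n_j,\delta,0}\setminus\{0\}: j\ge1\}$. Then the Cantor–Moran measure $\mu(N_n,B_n)$ is a spectral measure. -/

import Mathlib

open MeasureTheory Filter Topology
open scoped ENNReal BoundedContinuousFunction

noncomputable section

namespace CantorMoran

/-- `μ` is a spectral measure on `ℝ`: a Borel probability measure for which there is a countable
set `Λ` (a spectrum) such that the exponentials `x ↦ exp (2πiλx)`, `λ ∈ Λ`, form an orthonormal
basis of `L²(μ)`. -/
def IsSpectralMeasure (μ : Measure ℝ) : Prop :=
  IsProbabilityMeasure μ ∧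
    ∃ Λ : Set ℝ, Λ.Countable ∧
      ∃ e : HilbertBasis Λ ℂ (Lp ℂ 2 μ), ∀ l : Λ,
        (e l : ℝ → ℂ) =ᵐ[μ] fun x => Complex.exp (2 * Real.pi * Complex.I * ((l : ℝ) : ℂ) * x)

/-- The matrix `H = M^{-1/2} [exp (-2πi b l / N)]`, `b ∈ B`, `l ∈ L`, where `M = #B`. -/
def hadamardMatrix (N : ℕ) (B L : Finset ℤ) : Matrix B L ℂ :=
  Matrix.of fun b l =>
    ((1 / Real.sqrt (B.card : ℝ) : ℝ) : ℂ) *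
      Complex.exp (-2 * Real.pi * Complex.I * (((b : ℤ) : ℂ) * ((l : ℤ) : ℂ) / (N : ℂ)))

/-- `(N, B, L)` is a Hadamard triple: `N ≥ 2`, `B` and `L` are finite sets of integers of the same
cardinality `M` with `1 ≤ M ≤ N`, and the matrix `H` is unitary. -/
structure IsHadamardTriple (N : ℕ) (B L : Finset ℤ) : Prop where
  two_le : 2 ≤ N
  nonempty : B.Nonempty
  card_eq : L.card = B.card
  card_le : B.card ≤ N
  unitary : (hadamardMatrix N B L).conjTranspose * hadamardMatrix N B L = 1

/-- The measure `δ_A = (1 / #A) ∑_{a ∈ A} δ_a` for a (nonempty) finite set `A ⊆ ℝ`. -/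
def diracAvg (A : Finset ℝ) : Measure ℝ :=
  (A.card : ℝ≥0∞)⁻¹ • ∑ a ∈ A, Measure.dirac a

/-- The infinite convolution `m 0 ∗ m 1 ∗ m 2 ∗ ⋯` of probability measures on `ℝ`: the law of
`∑ x_i` when the `x_i` are independent with law `m i`. See `tendsto_partialConv` below for the
weak convergence of the finite convolutions to it. -/
def infConv (m : ℕ → Measure ℝ) : Measure ℝ :=
  (Measure.infinitePi m).map fun x => ∑' i, x i

/-- The measure `δ_{B_j / (N_1 ⋯ N_j)}`. The sequences are indexed from `0`, so that `N j`, `B j`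
stand for `N_{j+1}`, `B_{j+1}` in the usual numbering. -/
def factor (N : ℕ → ℕ) (B : ℕ → Finset ℤ) (j : ℕ) : Measure ℝ :=
  diracAvg ((B j).image fun b : ℤ => (b : ℝ) / ((∏ i ∈ Finset.range (j + 1), N i : ℕ) : ℝ))

/-- The tail `μ_{>n}`: the infinite convolution of all the factors but the first `n` ones. -/
def tailMeasure (N : ℕ → ℕ) (B : ℕ → Finset ℤ) (n : ℕ) : Measure ℝ :=
  infConv fun k => factor N B (n + k)

/-- The Cantor-Moran measure `μ(N_n, B_n) = δ_{B_1/N_1} ∗ δ_{B_2/(N_1N_2)} ∗ ⋯`. -/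
def cantorMoran (N : ℕ → ℕ) (B : ℕ → Finset ℤ) : Measure ℝ :=
  infConv (factor N B)

/-- The pull-back `ν_{>n}(E) = μ_{>n}((N_1 ⋯ N_n)⁻¹ E)` of the tail. -/
def nuTail (N : ℕ → ℕ) (B : ℕ → Finset ℤ) (n : ℕ) : Measure ℝ :=
  (tailMeasure N B n).map fun x => ((∏ i ∈ Finset.range n, N i : ℕ) : ℝ) * x

/-- Weak convergence of a sequence of measures, tested on bounded continuous functions. -/
def WeaklyConverges (ν : ℕ → Measure ℝ) (ρ : Measure ℝ) : Prop :=
  ∀ f : ℝ →ᵇ ℝ, Tendsto (fun n => ∫ x, f x ∂(ν n)) atTop (𝓝 (∫ x, f x ∂ρ))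

/-- `ρ = (δ_0 + δ_1) / 2`. -/
def rho : Measure ℝ := (2 : ℝ≥0∞)⁻¹ • (Measure.dirac 0 + Measure.dirac 1)

/-- The sum of sine problem holds for the collection `𝓑` of finite sets of positive integers: for
some `ε₀, δ₀ > 0` and every `B ∈ 𝓑`, the maximum of `|∑_{b ∈ B} sin (2πbx)|` over
`0 ≤ x ≤ 1/2 - δ₀` is at least `ε₀ #B`. -/
def SumOfSineHolds (𝓑 : Set (Finset ℤ)) : Prop :=
  ∃ ε₀ > (0 : ℝ), ∃ δ₀ > (0 : ℝ), ∀ B ∈ 𝓑,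
    ∃ x ∈ Set.Icc (0 : ℝ) (1 / 2 - δ₀),
      ε₀ * (B.card : ℝ) ≤ |∑ b ∈ B, Real.sin (2 * Real.pi * (b : ℝ) * x)|

open scoped Classical in
/-- `B_δ = {b ∈ B : b / N ∉ (δ, 1 - δ)}`. -/
def nearEnds (N : ℕ) (B : Finset ℤ) (δ : ℝ) : Finset ℤ :=
  B.filter fun b : ℤ => (b : ℝ) / (N : ℝ) ∉ Set.Ioo δ (1 - δ)

open scoped Classical in
/-- `B_{δ,0} = B_δ ∩ [0, Nδ]`. -/
def lowPart (N : ℕ) (B : Finset ℤ) (δ : ℝ) : Finset ℤ :=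
  (nearEnds N B δ).filter fun b : ℤ => (b : ℝ) ∈ Set.Icc (0 : ℝ) ((N : ℝ) * δ)

open scoped Classical in
/-- `B_{δ,1} = N - (B_δ ∩ N[1 - δ, 1))`. -/
def highPart (N : ℕ) (B : Finset ℤ) (δ : ℝ) : Finset ℤ :=
  ((nearEnds N B δ).filter fun b : ℤ => (b : ℝ) ∈ Set.Ico ((N : ℝ) * (1 - δ)) (N : ℝ)).image
    fun b : ℤ => (N : ℤ) - b

/-- `(N_n, B_n)` is symmetric: for all sufficiently small `δ > 0` and all `n ≥ n₀(δ)` one has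
`B_n = B_{n,δ}` and `B_{n,δ,1} = B_{n,δ,0} \ {0}`. -/
def IsSymmetric (N : ℕ → ℕ) (B : ℕ → Finset ℤ) : Prop :=
  ∃ δ₁ > (0 : ℝ), ∀ δ : ℝ, 0 < δ → δ < δ₁ → ∃ n₀ : ℕ, ∀ n ≥ n₀,
    B n = nearEnds (N n) (B n) δ ∧
      highPart (N n) (B n) δ = (lowPart (N n) (B n) δ).erase 0

/-! The infinite convolution above is the weak limit of the finite convolutions. -/

/-- The finite convolution `m 0 ∗ ⋯ ∗ m (n - 1)`. -/
def partialConv (m : ℕ → Measure ℝ) : ℕ → Measure ℝ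
  | 0 => Measure.dirac 0
  | n + 1 => (partialConv m n).conv (m n)

theorem map_partialSum (m : ℕ → Measure ℝ) [∀ i, IsProbabilityMeasure (m i)] (n : ℕ) :
    (Measure.infinitePi m).map (fun x => ∑ i ∈ Finset.range n, x i) = partialConv m n := by
  induction n with
  | zero => simp [partialConv]
  | succ n ih =>
    have hind : ProbabilityTheory.iIndepFun (fun i (x : ℕ → ℝ) => x i) (Measure.infinitePi m) :=
      ProbabilityTheory.iIndepFun_infinitePi (X := fun _ x => x) (fun _ => measurable_id)
    have h2 := hind.indepFun_finsetSum_of_notMem (fun i => measurable_pi_apply i)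
      (s := Finset.range n) (i := n) (by simp)
    have h3 := h2.map_add_eq_map_conv_map (by fun_prop) (by fun_prop)
    have e1 : (fun x : ℕ → ℝ => ∑ i ∈ Finset.range (n + 1), x i)
        = (∑ j ∈ Finset.range n, fun x : ℕ → ℝ => x j) + fun x => x n := by
      ext x; simp [Finset.sum_range_succ]
    have e2 : (∑ j ∈ Finset.range n, fun x : ℕ → ℝ => x j)
        = fun x : ℕ → ℝ => ∑ i ∈ Finset.range n, x i := by
      ext x; simp
    rw [e1, h3, e2, ih, Measure.infinitePi_map_eval, partialConv]

theorem aemeasurable_tsum (m : ℕ → Measure ℝ)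
    (hs : ∀ᵐ x ∂(Measure.infinitePi m), Summable x) :
    AEMeasurable (fun x : ℕ → ℝ => ∑' i, x i) (Measure.infinitePi m) := by
  refine aemeasurable_of_tendsto_metrizable_ae atTop
    (f := fun n (x : ℕ → ℝ) => ∑ i ∈ Finset.range n, x i) (fun n => by fun_prop) ?_
  filter_upwards [hs] with x hx using hx.hasSum.tendsto_sum_nat

theorem tendsto_partialConv (m : ℕ → Measure ℝ) [∀ i, IsProbabilityMeasure (m i)]
    (hs : ∀ᵐ x ∂(Measure.infinitePi m), Summable x) :
    WeaklyConverges (partialConv m) (infConv m) := by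
  intro f
  have hm := aemeasurable_tsum m hs
  simp_rw [← map_partialSum m, infConv]
  rw [integral_map hm f.continuous.aestronglyMeasurable]
  have : ∀ n, ∫ y, f y ∂((Measure.infinitePi m).map fun x => ∑ i ∈ Finset.range n, x i)
      = ∫ x, f (∑ i ∈ Finset.range n, x i) ∂(Measure.infinitePi m) := fun n =>
    integral_map (by fun_prop) f.continuous.aestronglyMeasurable
  simp_rw [this]
  refine tendsto_integral_of_dominated_convergence (fun _ => ‖f‖)
    (fun n => (f.continuous.measurable.comp (by fun_prop)).aestronglyMeasurable)
    (integrable_const _) (fun n => Eventually.of_forall fun x => f.norm_coe_le_norm _) ?_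
  filter_upwards [hs] with x hx using
    (f.continuous.tendsto _).comp hx.hasSum.tendsto_sum_nat

theorem isProbabilityMeasure_diracAvg {A : Finset ℝ} (hA : A.Nonempty) :
    IsProbabilityMeasure (diracAvg A) := by
  constructor
  have : (A.card : ℝ≥0∞) ≠ 0 := by simpa using hA.ne_empty
  simp [diracAvg, ENNReal.inv_mul_cancel this]

theorem isProbabilityMeasure_factor {N : ℕ → ℕ} {B : ℕ → Finset ℤ} (hB : ∀ n, (B n).Nonempty)
    (j : ℕ) : IsProbabilityMeasure (factor N B j) :=
  isProbabilityMeasure_diracAvg ((hB j).image _)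

theorem summable_factor {N : ℕ → ℕ} {B : ℕ → Finset ℤ} (hN : ∀ n, 2 ≤ N n)
    (hB : ∀ n, (B n).Nonempty) (hBN : ∀ n, B n ⊆ Finset.Ico 0 (N n : ℤ)) (n : ℕ) :
    ∀ᵐ x ∂(Measure.infinitePi fun k => factor N B (n + k)), Summable x := by
  have := fun j => isProbabilityMeasure_factor (N := N) hB j
  have hb : ∀ k, ∀ᵐ x ∂(Measure.infinitePi fun k => factor N B (n + k)),
      ‖x k‖ ≤ (1 / 2 : ℝ) ^ k := by
    intro k
    have h1 : ∀ᵐ y ∂(factor N B (n + k)), ‖y‖ ≤ (1 / 2 : ℝ) ^ k := by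
      refine Measure.ae_smul_measure ?_ _
      rw [← Measure.sum_coe_finset, Measure.ae_sum_iff]
      rintro ⟨a, ha⟩
      rw [ae_dirac_eq]
      obtain ⟨b, hb, rfl⟩ := Finset.mem_image.1 ha
      obtain ⟨hb0, hb1⟩ := Finset.mem_Ico.1 (hBN _ hb)
      have hb0' : (0 : ℝ) ≤ b := by exact_mod_cast hb0
      have hb1' : (b : ℝ) ≤ N (n + k) := by exact_mod_cast hb1.le
      have hp : (2 : ℝ) ^ k ≤ ((∏ i ∈ Finset.range (n + k), N i : ℕ) : ℝ) := by
        have : 2 ^ (n + k) ≤ ∏ i ∈ Finset.range (n + k), N i := by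
          simpa using Finset.prod_le_prod' (s := Finset.range (n + k)) (fun i _ => hN i)
        have h' : 2 ^ k ≤ ∏ i ∈ Finset.range (n + k), N i :=
          (Nat.pow_le_pow_right (by norm_num) (by omega)).trans this
        exact_mod_cast h'
      have hNpos : (0 : ℝ) < N (n + k) := by
        have := hN (n + k)
        exact_mod_cast (by omega : 0 < N (n + k))
      have h2 : (0 : ℝ) < 2 ^ k := by positivity
      have hp0 := h2.trans_le hp
      change ‖(b : ℝ) / _‖ ≤ _
      rw [Finset.prod_range_succ, Nat.cast_mul, Real.norm_of_nonneg (by positivity), one_div,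
        inv_pow, div_le_iff₀ (mul_pos hp0 hNpos), ← mul_assoc]
      refine hb1'.trans (le_mul_of_one_le_left hNpos.le ?_)
      rw [inv_mul_eq_div, one_le_div h2]
      exact hp
    rw [← Measure.infinitePi_map_eval (fun k => factor N B (n + k)) k] at h1
    exact ae_of_ae_map (measurable_pi_apply k).aemeasurable h1
  filter_upwards [ae_all_iff.2 hb] with x hx
  exact Summable.of_norm_bounded (summable_geometric_of_lt_one (by norm_num) (by norm_num)) hx

theorem tendsto_tailMeasure {N : ℕ → ℕ} {B : ℕ → Finset ℤ} (hN : ∀ n, 2 ≤ N n)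
    (hB : ∀ n, (B n).Nonempty) (hBN : ∀ n, B n ⊆ Finset.Ico 0 (N n : ℤ)) (n : ℕ) :
    WeaklyConverges (partialConv fun k => factor N B (n + k)) (tailMeasure N B n) := by
  have := fun j => isProbabilityMeasure_factor (N := N) hB j
  exact tendsto_partialConv _ (summable_factor hN hB hBN n)

theorem tendsto_cantorMoran {N : ℕ → ℕ} {B : ℕ → Finset ℤ} (hN : ∀ n, 2 ≤ N n)
    (hB : ∀ n, (B n).Nonempty) (hBN : ∀ n, B n ⊆ Finset.Ico 0 (N n : ℤ)) :
    WeaklyConverges (partialConv (factor N B)) (cantorMoran N B) := by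
  simpa [tailMeasure, cantorMoran] using tendsto_tailMeasure hN hB hBN 0

end CantorMoran

end

/-! The spectrum is, up to sign, a union of increasing finite integer sets. Each is complete for the
transform of the first `m` factors: Parseval holds there with finitely many terms, by unitarity of
the Hadamard matrices (`IsHadamardTriple.sum_norm_mask_sq`). This head transform has period `scale N
m`, so new frequencies may be moved by multiples of that period. If the moves place every frequency
where the transform of the rescaled tail `nuTail` is at least `ε`, the head is bounded by a constant
times the transform of the full measure, and dominated convergence carries Parseval to the limit
(`exists_hasSum_norm_cf_sq`). Parseval for every exponential yields an orthonormal basis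
(`isSpectralMeasure_of_hasSum`).

What remains is uniform positivity: for infinitely many `m`, every `x` has an integer translate
where the tail transform is at least `ε` (`exists_frequently_le_norm_cf_nuTail`). Weak convergence
gives it away from `x ≡ 1/2` mod 1, because the transform of `rho` has modulus `|cos πx|`. That
limit vanishes at all half-integers, so near them one more factor is split off: the tail transform
at `ξ` is the mask at `y = ξ/N` times the next tail transform at `y`. When `Ny` is a half-integer,
the symmetric digits `c` and `N - c` contribute `e(cy) - e(-cy) = 2i sin(2πcy)`, so the mask is
essentially a sum of sines. A translate brings `y` within `1/(2N)` of a point `x₀` where that sum is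
large, and `x₀ ≤ 1/2 - δ₀` keeps the second factor away from zero. -/

noncomputable section

namespace CantorMoran

/-! ### Characters and Fourier transforms of measures. -/

/-- The character `x ↦ exp (2πix)`. -/
def expo (x : ℝ) : ℂ := Complex.exp (2 * Real.pi * Complex.I * x)

theorem expo_zero : expo 0 = 1 := by simp [expo]

theorem expo_add (x y : ℝ) : expo (x + y) = expo x * expo y := by
  rw [expo, expo, expo, ← Complex.exp_add]; push_cast; ring_nf

theorem expo_int (k : ℤ) : expo k = 1 := by
  rw [expo, Complex.exp_eq_one_iff]
  exact ⟨k, by push_cast; ring⟩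

theorem expo_eq (x : ℝ) : expo x = Complex.exp (((2 * Real.pi * x : ℝ) : ℂ) * Complex.I) := by
  rw [expo]; push_cast; ring_nf

theorem norm_expo (x : ℝ) : ‖expo x‖ = 1 := by
  rw [expo_eq, Complex.norm_exp_ofReal_mul_I]

theorem conj_expo (x : ℝ) : (starRingEnd ℂ) (expo x) = expo (-x) := by
  rw [expo_eq, expo_eq, ← Complex.exp_conj, map_mul, Complex.conj_ofReal, Complex.conj_I]
  push_cast; ring_nf

theorem expo_re (x : ℝ) : (expo x).re = Real.cos (2 * Real.pi * x) := by
  rw [expo_eq, Complex.exp_ofReal_mul_I_re]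

theorem expo_im (x : ℝ) : (expo x).im = Real.sin (2 * Real.pi * x) := by
  rw [expo_eq, Complex.exp_ofReal_mul_I_im]

theorem continuous_expo : Continuous expo := by unfold expo; fun_prop

theorem norm_expo_sub_one_le (x : ℝ) : ‖expo x - 1‖ ≤ 2 * Real.pi * |x| := by
  have h := Real.norm_exp_I_mul_ofReal_sub_one_le (x := 2 * Real.pi * x)
  rw [mul_comm, ← expo_eq] at h
  simpa [abs_mul, abs_of_pos Real.pi_pos] using h

theorem norm_expo_sub_le (x y : ℝ) : ‖expo x - expo y‖ ≤ 2 * Real.pi * |x - y| := by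
  have : expo x - expo y = expo y * (expo (x - y) - 1) := by
    rw [mul_sub, ← expo_add]; simp
  rw [this, norm_mul, norm_expo, one_mul]
  exact norm_expo_sub_one_le _

/-- The Fourier transform `ξ ↦ ∫ exp (2πiξx) dμ(x)`. -/
def cf (μ : Measure ℝ) (ξ : ℝ) : ℂ := charFun μ (2 * Real.pi * ξ)

theorem cf_eq_integral (μ : Measure ℝ) (ξ : ℝ) : cf μ ξ = ∫ x, expo (ξ * x) ∂μ := by
  rw [cf, charFun_apply_real]
  congr 1 with x
  rw [expo]; push_cast; ring_nf

theorem cf_zero (μ : Measure ℝ) [IsProbabilityMeasure μ] : cf μ 0 = 1 := by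
  simp [cf_eq_integral, expo_zero]

theorem integrable_expo (μ : Measure ℝ) [IsFiniteMeasure μ] (ξ : ℝ) :
    Integrable (fun x => expo (ξ * x)) μ := by
  refine Integrable.of_bound (C := 1) ?_ (ae_of_all _ fun x => (norm_expo _).le)
  exact (continuous_expo.comp (by fun_prop)).aestronglyMeasurable

theorem WeaklyConverges.tendsto_cf {ν : ℕ → Measure ℝ} {ρ : Measure ℝ}
    [∀ n, IsFiniteMeasure (ν n)] [IsFiniteMeasure ρ] (h : WeaklyConverges ν ρ) (ξ : ℝ) :
    Tendsto (fun n => cf (ν n) ξ) atTop (𝓝 (cf ρ ξ)) := by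
  let c : ℝ →ᵇ ℝ := BoundedContinuousFunction.ofNormedAddCommGroup
    (fun x => Real.cos (2 * Real.pi * (ξ * x))) (by fun_prop) 1 (fun x => Real.abs_cos_le_one _)
  let s : ℝ →ᵇ ℝ := BoundedContinuousFunction.ofNormedAddCommGroup
    (fun x => Real.sin (2 * Real.pi * (ξ * x))) (by fun_prop) 1 (fun x => Real.abs_sin_le_one _)
  have key : ∀ μ : Measure ℝ, IsFiniteMeasure μ →
      cf μ ξ = ((∫ x, c x ∂μ : ℝ) : ℂ) + ((∫ x, s x ∂μ : ℝ) : ℂ) * Complex.I := by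
    intro μ _
    rw [cf_eq_integral]
    have h1 := integral_re_add_im (integrable_expo μ ξ)
    simp only [RCLike.re_to_complex, RCLike.im_to_complex, expo_re, expo_im] at h1
    exact h1.symm
  simp_rw [fun n => key (ν n) inferInstance, key ρ inferInstance]
  exact ((Complex.continuous_ofReal.tendsto _).comp (h c)).add
    (((Complex.continuous_ofReal.tendsto _).comp (h s)).mul_const _)

theorem isProbabilityMeasure_partialConv (m : ℕ → Measure ℝ) [∀ i, IsProbabilityMeasure (m i)]
    (n : ℕ) : IsProbabilityMeasure (partialConv m n) := by
  rw [← map_partialSum]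
  exact Measure.isProbabilityMeasure_map (by fun_prop)

theorem cf_partialConv (m : ℕ → Measure ℝ) [∀ i, IsProbabilityMeasure (m i)] (n : ℕ) (ξ : ℝ) :
    cf (partialConv m n) ξ = ∏ i ∈ Finset.range n, cf (m i) ξ := by
  induction n with
  | zero => simp [partialConv, cf]
  | succ n ih =>
    have := isProbabilityMeasure_partialConv m n
    rw [partialConv, Finset.prod_range_succ, ← ih, cf, charFun_conv]
    rfl

theorem isProbabilityMeasure_infConv (m : ℕ → Measure ℝ) [∀ i, IsProbabilityMeasure (m i)]
    (hs : ∀ᵐ x ∂(Measure.infinitePi m), Summable x) : IsProbabilityMeasure (infConv m) :=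
  Measure.isProbabilityMeasure_map (aemeasurable_tsum m hs)

theorem cf_diracAvg_image (B : Finset ℤ) {p : ℝ} (hp : p ≠ 0) (ξ : ℝ) :
    cf (diracAvg (B.image fun b : ℤ => (b : ℝ) / p)) ξ
      = (B.card : ℂ)⁻¹ * ∑ b ∈ B, expo (b * (ξ / p)) := by
  have hinj : Function.Injective fun b : ℤ => (b : ℝ) / p := by
    intro a b h
    exact_mod_cast (div_left_inj' hp).1 h
  rw [cf_eq_integral, diracAvg, integral_smul_measure, Finset.card_image_of_injective _ hinj,
    integral_finsetSum_measure fun a _ => integrable_expo _ _]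
  simp only [integral_dirac]
  rw [Finset.sum_image hinj.injOn]
  simp only [ENNReal.toReal_inv, ENNReal.toReal_natCast, Complex.real_smul, Complex.ofReal_inv,
    Complex.ofReal_natCast]
  congr 1
  refine Finset.sum_congr rfl fun b _ => ?_
  congr 1; ring

/-! ### Mask polynomials, product formulas and Lipschitz bounds. -/

/-- The mask polynomial `x ↦ (1 / #B) ∑_{b ∈ B} exp (2πibx)`. -/
def mask (B : Finset ℤ) (x : ℝ) : ℂ := (B.card : ℂ)⁻¹ * ∑ b ∈ B, expo (b * x)

theorem norm_mask_le_one (B : Finset ℤ) (x : ℝ) : ‖mask B x‖ ≤ 1 := by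
  rw [mask, norm_mul, norm_inv, Complex.norm_natCast]
  have h : ‖∑ b ∈ B, expo (b * x)‖ ≤ B.card := by
    simpa [norm_expo] using norm_sum_le B fun b : ℤ => expo (b * x)
  calc _ ≤ (B.card : ℝ)⁻¹ * B.card := by gcongr
    _ ≤ 1 := inv_mul_le_one

theorem mask_add_int (B : Finset ℤ) (x : ℝ) (k : ℤ) : mask B (x + k) = mask B x := by
  rw [mask, mask]
  congr 1
  refine Finset.sum_congr rfl fun b _ => ?_
  rw [mul_add, expo_add, ← Int.cast_mul, expo_int, mul_one]

theorem norm_mask_sub_le {B : Finset ℤ} {R : ℝ} (hR0 : 0 ≤ R) (hR : ∀ b ∈ B, |(b : ℝ)| ≤ R)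
    (x y : ℝ) : ‖mask B x - mask B y‖ ≤ 2 * Real.pi * R * |x - y| := by
  rw [mask, mask, ← mul_sub, ← Finset.sum_sub_distrib, norm_mul, norm_inv, Complex.norm_natCast]
  have h : ‖∑ b ∈ B, (expo (b * x) - expo (b * y))‖
      ≤ ∑ _b ∈ B, 2 * Real.pi * R * |x - y| := by
    refine norm_sum_le_of_le _ fun b hb => (norm_expo_sub_le _ _).trans ?_
    rw [← mul_sub, abs_mul, mul_assoc _ R]
    have := hR b hb
    have := Real.pi_pos
    gcongr
  rw [Finset.sum_const, nsmul_eq_mul] at h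
  have hpi := Real.pi_pos
  calc _ ≤ (B.card : ℝ)⁻¹ * (B.card * (2 * Real.pi * R * |x - y|)) := by gcongr
    _ = ((B.card : ℝ)⁻¹ * B.card) * (2 * Real.pi * R * |x - y|) := by ring
    _ ≤ 1 * (2 * Real.pi * R * |x - y|) := by
      gcongr
      exact inv_mul_le_one
    _ = _ := one_mul _

/-- The product `N_1 ⋯ N_n`. -/
def scale (N : ℕ → ℕ) (n : ℕ) : ℕ := ∏ i ∈ Finset.range n, N i

theorem scale_succ (N : ℕ → ℕ) (n : ℕ) : scale N (n + 1) = scale N n * N n :=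
  Finset.prod_range_succ _ _

theorem two_pow_le_scale {N : ℕ → ℕ} (hN : ∀ n, 2 ≤ N n) (n : ℕ) : 2 ^ n ≤ scale N n := by
  simpa [scale] using Finset.prod_le_prod' (s := Finset.range n) (fun i _ => hN i)

theorem scale_pos {N : ℕ → ℕ} (hN : ∀ n, 2 ≤ N n) (n : ℕ) : (0 : ℝ) < scale N n := by
  exact_mod_cast (by positivity : 0 < 2 ^ n).trans_le (two_pow_le_scale hN n)

theorem cf_factor {N : ℕ → ℕ} (hN : ∀ n, 2 ≤ N n) (B : ℕ → Finset ℤ) (j : ℕ) (ξ : ℝ) :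
    cf (factor N B j) ξ = mask (B j) (ξ / scale N (j + 1)) :=
  cf_diracAvg_image _ (scale_pos hN _).ne' _

theorem isProbabilityMeasure_tailMeasure {N : ℕ → ℕ} {B : ℕ → Finset ℤ} (hN : ∀ n, 2 ≤ N n)
    (hB : ∀ n, (B n).Nonempty) (hBN : ∀ n, B n ⊆ Finset.Ico 0 (N n : ℤ)) (n : ℕ) :
    IsProbabilityMeasure (tailMeasure N B n) := by
  have := fun j => isProbabilityMeasure_factor (N := N) hB j
  exact isProbabilityMeasure_infConv _ (summable_factor hN hB hBN n)

theorem tendsto_prod_mask {N : ℕ → ℕ} {B : ℕ → Finset ℤ} (hN : ∀ n, 2 ≤ N n)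
    (hB : ∀ n, (B n).Nonempty) (hBN : ∀ n, B n ⊆ Finset.Ico 0 (N n : ℤ)) (n : ℕ) (ξ : ℝ) :
    Tendsto (fun k => ∏ i ∈ Finset.range k, mask (B (n + i)) (ξ / scale N (n + i + 1))) atTop
      (𝓝 (cf (tailMeasure N B n) ξ)) := by
  have := fun j => isProbabilityMeasure_factor (N := N) hB j
  have := fun k => isProbabilityMeasure_partialConv (fun k => factor N B (n + k)) k
  have := isProbabilityMeasure_tailMeasure hN hB hBN n
  have h := (tendsto_tailMeasure hN hB hBN n).tendsto_cf ξ
  simpa only [cf_partialConv, cf_factor hN] using h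

theorem cf_tailMeasure_succ {N : ℕ → ℕ} {B : ℕ → Finset ℤ} (hN : ∀ n, 2 ≤ N n)
    (hB : ∀ n, (B n).Nonempty) (hBN : ∀ n, B n ⊆ Finset.Ico 0 (N n : ℤ)) (n : ℕ) (ξ : ℝ) :
    cf (tailMeasure N B n) ξ
      = mask (B n) (ξ / scale N (n + 1)) * cf (tailMeasure N B (n + 1)) ξ := by
  have h1 := (tendsto_add_atTop_iff_nat 1).2 (tendsto_prod_mask hN hB hBN n ξ)
  have h2 := (tendsto_prod_mask hN hB hBN (n + 1) ξ).const_mul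
    (mask (B n) (ξ / scale N (n + 1)))
  refine tendsto_nhds_unique h1 (h2.congr fun k => ?_)
  rw [Finset.prod_range_succ', mul_comm]
  simp only [add_zero, show ∀ i, n + 1 + i = n + (i + 1) by intro i; omega]

/-- Digits are at most `N n - 1`, and `(N n - 1) / scale N (n + 1)` is exactly the difference on the
right, so these bounds telescope over the factors of a product. -/
theorem norm_mask_div_scale_sub_le {N : ℕ → ℕ} {B : ℕ → Finset ℤ} (hN : ∀ n, 2 ≤ N n)
    (hBN : ∀ n, B n ⊆ Finset.Ico 0 (N n : ℤ)) (n : ℕ) (s t : ℝ) :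
    ‖mask (B n) (s / scale N (n + 1)) - mask (B n) (t / scale N (n + 1))‖
      ≤ 2 * Real.pi * |s - t| * (1 / scale N n - 1 / scale N (n + 1)) := by
  have hN1 : (1 : ℝ) ≤ N n := by exact_mod_cast (by norm_num : 1 ≤ 2).trans (hN n)
  have hp := scale_pos hN n
  have hp1 := scale_pos hN (n + 1)
  refine (norm_mask_sub_le (R := N n - 1) (by linarith) (fun b hb => ?_) _ _).trans_eq ?_
  · obtain ⟨h0, h1⟩ := Finset.mem_Ico.1 (hBN n hb)
    rw [abs_of_nonneg (by exact_mod_cast h0)]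
    have h2 : b ≤ (N n : ℤ) - 1 := by omega
    exact_mod_cast h2
  · rw [← sub_div, abs_div, abs_of_pos hp1]
    rw [scale_succ] at hp1 ⊢
    push_cast at hp1 ⊢
    field_simp

theorem norm_prod_mask_sub_le {N : ℕ → ℕ} {B : ℕ → Finset ℤ} (hN : ∀ n, 2 ≤ N n)
    (hBN : ∀ n, B n ⊆ Finset.Ico 0 (N n : ℤ)) (n k : ℕ) (s t : ℝ) :
    ‖∏ i ∈ Finset.range k, mask (B (n + i)) (s / scale N (n + i + 1))
      - ∏ i ∈ Finset.range k, mask (B (n + i)) (t / scale N (n + i + 1))‖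
      ≤ 2 * Real.pi * |s - t| * (1 / scale N n - 1 / scale N (n + k)) := by
  induction k with
  | zero => simp
  | succ k ih =>
    rw [Finset.prod_range_succ, Finset.prod_range_succ]
    set a := ∏ i ∈ Finset.range k, mask (B (n + i)) (s / scale N (n + i + 1))
    set b := ∏ i ∈ Finset.range k, mask (B (n + i)) (t / scale N (n + i + 1))
    set c := mask (B (n + k)) (s / scale N (n + k + 1))
    set d := mask (B (n + k)) (t / scale N (n + k + 1))
    have hb : ‖b‖ ≤ 1 := by
      rw [norm_prod]
      exact Finset.prod_le_one (fun _ _ => norm_nonneg _) fun _ _ => norm_mask_le_one _ _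
    have hc : ‖c‖ ≤ 1 := norm_mask_le_one _ _
    have hcd := norm_mask_div_scale_sub_le hN hBN (n + k) s t
    calc ‖a * c - b * d‖ = ‖(a - b) * c + b * (c - d)‖ := by congr 1; ring
      _ ≤ ‖a - b‖ * ‖c‖ + ‖b‖ * ‖c - d‖ := by
        simpa only [norm_mul] using norm_add_le ((a - b) * c) (b * (c - d))
      _ ≤ ‖a - b‖ * 1 + 1 * ‖c - d‖ := by gcongr
      _ ≤ 2 * Real.pi * |s - t| * (1 / scale N n - 1 / scale N (n + k))
          + 2 * Real.pi * |s - t| * (1 / scale N (n + k) - 1 / scale N (n + k + 1)) := by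
        rw [mul_one, one_mul]; exact add_le_add ih hcd
      _ = _ := by rw [← add_assoc n k 1]; ring

theorem norm_cf_tailMeasure_sub_le {N : ℕ → ℕ} {B : ℕ → Finset ℤ} (hN : ∀ n, 2 ≤ N n)
    (hB : ∀ n, (B n).Nonempty) (hBN : ∀ n, B n ⊆ Finset.Ico 0 (N n : ℤ)) (n : ℕ) (s t : ℝ) :
    ‖cf (tailMeasure N B n) s - cf (tailMeasure N B n) t‖
      ≤ 2 * Real.pi * |s - t| / scale N n := by
  refine le_of_tendsto ((tendsto_prod_mask hN hB hBN n s).sub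
    (tendsto_prod_mask hN hB hBN n t)).norm (Eventually.of_forall fun k => ?_)
  refine (norm_prod_mask_sub_le hN hBN n k s t).trans ?_
  rw [div_eq_mul_one_div (2 * Real.pi * |s - t|)]
  have := Real.pi_pos
  exact mul_le_mul_of_nonneg_left
    (sub_le_self _ (one_div_nonneg.2 (scale_pos hN (n + k)).le)) (by positivity)

theorem cf_nuTail (N : ℕ → ℕ) (B : ℕ → Finset ℤ) (n : ℕ) (ξ : ℝ) :
    cf (nuTail N B n) ξ = cf (tailMeasure N B n) (scale N n * ξ) := by
  rw [cf, nuTail, charFun_map_mul, cf, scale]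
  congr 1; ring

theorem isProbabilityMeasure_nuTail {N : ℕ → ℕ} {B : ℕ → Finset ℤ} (hN : ∀ n, 2 ≤ N n)
    (hB : ∀ n, (B n).Nonempty) (hBN : ∀ n, B n ⊆ Finset.Ico 0 (N n : ℤ)) (n : ℕ) :
    IsProbabilityMeasure (nuTail N B n) := by
  have := isProbabilityMeasure_tailMeasure hN hB hBN n
  exact Measure.isProbabilityMeasure_map (by fun_prop)

/-- The Lipschitz constant is independent of `n`; this makes the convergence to the transform of
`rho` uniform on `[0, 1]` and absorbs bounded shifts of frequencies. -/
theorem norm_cf_nuTail_sub_le {N : ℕ → ℕ} {B : ℕ → Finset ℤ} (hN : ∀ n, 2 ≤ N n)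
    (hB : ∀ n, (B n).Nonempty) (hBN : ∀ n, B n ⊆ Finset.Ico 0 (N n : ℤ)) (n : ℕ) (s t : ℝ) :
    ‖cf (nuTail N B n) s - cf (nuTail N B n) t‖ ≤ 2 * Real.pi * |s - t| := by
  rw [cf_nuTail, cf_nuTail]
  have hp := scale_pos hN n
  refine (norm_cf_tailMeasure_sub_le hN hB hBN n _ _).trans_eq ?_
  rw [← mul_sub, abs_mul, abs_of_pos hp]
  field_simp

theorem cf_nuTail_eq_mask_mul {N : ℕ → ℕ} {B : ℕ → Finset ℤ} (hN : ∀ n, 2 ≤ N n)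
    (hB : ∀ n, (B n).Nonempty) (hBN : ∀ n, B n ⊆ Finset.Ico 0 (N n : ℤ)) (n : ℕ) (ξ : ℝ) :
    cf (nuTail N B n) ξ = mask (B n) (ξ / N n) * cf (nuTail N B (n + 1)) (ξ / N n) := by
  have hp := scale_pos hN n
  have hp1 := scale_pos hN (n + 1)
  rw [cf_nuTail, cf_nuTail, cf_tailMeasure_succ hN hB hBN]
  rw [scale_succ] at hp1 ⊢
  push_cast at hp1 ⊢
  have hN0 : (N n : ℝ) ≠ 0 := fun h => by simp [h] at hp1
  congr 2 <;> field_simp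

/-- The Fourier transform of the convolution of the first `n` factors. -/
def headCf (N : ℕ → ℕ) (B : ℕ → Finset ℤ) (n : ℕ) (ξ : ℝ) : ℂ :=
  ∏ i ∈ Finset.range n, mask (B i) (ξ / scale N (i + 1))

theorem cf_cantorMoran {N : ℕ → ℕ} {B : ℕ → Finset ℤ} (hN : ∀ n, 2 ≤ N n)
    (hB : ∀ n, (B n).Nonempty) (hBN : ∀ n, B n ⊆ Finset.Ico 0 (N n : ℤ)) (n : ℕ) (ξ : ℝ) :
    cf (cantorMoran N B) ξ = headCf N B n ξ * cf (nuTail N B n) (ξ / scale N n) := by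
  rw [cf_nuTail, mul_div_cancel₀ _ (scale_pos hN n).ne']
  induction n with
  | zero => simp [headCf, tailMeasure, cantorMoran]
  | succ n ih =>
    rw [ih, cf_tailMeasure_succ hN hB hBN, ← mul_assoc, headCf, headCf, Finset.prod_range_succ]

theorem tendsto_headCf {N : ℕ → ℕ} {B : ℕ → Finset ℤ} (hN : ∀ n, 2 ≤ N n)
    (hB : ∀ n, (B n).Nonempty) (hBN : ∀ n, B n ⊆ Finset.Ico 0 (N n : ℤ)) (ξ : ℝ) :
    Tendsto (fun n => headCf N B n ξ) atTop (𝓝 (cf (cantorMoran N B) ξ)) := by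
  simpa [headCf, tailMeasure, cantorMoran] using tendsto_prod_mask hN hB hBN 0 ξ

theorem headCf_zero_right (N : ℕ → ℕ) {B : ℕ → Finset ℤ} (hB : ∀ n, (B n).Nonempty) (n : ℕ) :
    headCf N B n 0 = 1 := by
  refine Finset.prod_eq_one fun i _ => ?_
  have : ((B i).card : ℂ) ≠ 0 := by exact_mod_cast (hB i).card_pos.ne'
  simp [mask, expo_zero, this]

theorem headCf_add_scale_mul {N : ℕ → ℕ} (hN : ∀ n, 2 ≤ N n) (B : ℕ → Finset ℤ) (n : ℕ)
    (ξ : ℝ) (k : ℤ) : headCf N B n (ξ + scale N n * k) = headCf N B n ξ := by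
  refine Finset.prod_congr rfl fun i hi => ?_
  have hdvd : scale N (i + 1) ∣ scale N n :=
    Finset.prod_dvd_prod_of_subset _ _ _
      (Finset.range_subset_range.2 (Finset.mem_range.1 hi))
  obtain ⟨q, hq⟩ := hdvd
  have hp := (scale_pos hN (i + 1)).ne'
  rw [hq, ← mask_add_int _ (ξ / scale N (i + 1)) (q * k)]
  congr 1
  push_cast
  field_simp

/-! ### Hadamard triples and finite complete sets of frequencies. -/

/-- Expanding the squared modulus gives a double sum over digits; orthogonality of the rows of the
Hadamard matrix kills the off-diagonal terms. Unitarity is given for the columns and passes to the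
rows because the matrix is square. -/
theorem IsHadamardTriple.sum_norm_mask_sq {N : ℕ} {B L : Finset ℤ} (h : IsHadamardTriple N B L)
    (x : ℝ) : ∑ l ∈ L, ‖mask B ((x + l) / N)‖ ^ 2 = 1 := by
  have hN : (N : ℝ) ≠ 0 := by have := h.two_le; positivity
  have hM : (0 : ℝ) < B.card := by exact_mod_cast h.nonempty.card_pos
  have hH : hadamardMatrix N B L * (hadamardMatrix N B L).conjTranspose = 1 :=
    (Matrix.mul_eq_one_comm_of_card_eq _ _ _ (by simpa using h.card_eq)).1 h.unitary
  have hentry : ∀ b l, hadamardMatrix N B L b l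
      = ((1 / Real.sqrt (B.card : ℝ) : ℝ) : ℂ) * expo (-((b : ℤ) * (l : ℤ) / N)) := by
    intro b l
    rw [hadamardMatrix, Matrix.of_apply, expo]
    congr 2
    push_cast
    ring
  have hsq : ((1 / Real.sqrt (B.card : ℝ) : ℝ) : ℂ) * ((1 / Real.sqrt (B.card : ℝ) : ℝ) : ℂ)
      = (B.card : ℂ)⁻¹ := by
    rw [← Complex.ofReal_mul, div_mul_div_comm, Real.mul_self_sqrt hM.le]
    push_cast; ring
  have hMc : (B.card : ℂ) ≠ 0 := by exact_mod_cast hM.ne'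
  have horth : ∀ b ∈ B, ∀ b' ∈ B,
      ∑ l ∈ L, expo ((b' - b) * (l / N)) = if b = b' then (B.card : ℂ) else 0 := by
    intro b hb b' hb'
    have h1 := congrFun (congrFun hH ⟨b, hb⟩) ⟨b', hb'⟩
    rw [Matrix.mul_apply] at h1
    simp only [Matrix.conjTranspose_apply, hentry, RCLike.star_def, map_mul, Complex.conj_ofReal,
      conj_expo] at h1
    have h2 : ∀ l : L, ((1 / Real.sqrt (B.card : ℝ) : ℝ) : ℂ) * expo (-((b : ℝ) * (l : ℤ) / N))
        * (((1 / Real.sqrt (B.card : ℝ) : ℝ) : ℂ) * expo (- -((b' : ℝ) * (l : ℤ) / N)))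
        = (B.card : ℂ)⁻¹ * expo ((b' - b) * ((l : ℤ) / N)) := by
      intro l
      rw [← hsq, show ((b' : ℝ) - b) * ((l : ℤ) / N)
        = -((b : ℝ) * (l : ℤ) / N) + - -((b' : ℝ) * (l : ℤ) / N) by ring, expo_add]
      ring
    rw [Finset.sum_congr rfl fun l _ => h2 l, ← Finset.mul_sum,
      Finset.sum_coe_sort L fun l => expo (((b' : ℝ) - b) * ((l : ℝ) / N)),
      inv_mul_eq_iff_eq_mul₀ hMc] at h1
    rw [h1, Matrix.one_apply]
    simp
  have hterm : ∀ l : ℤ, ((‖mask B ((x + l) / N)‖ ^ 2 : ℝ) : ℂ)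
      = (B.card : ℂ)⁻¹ * (B.card : ℂ)⁻¹ * ∑ b ∈ B, ∑ b' ∈ B,
        expo ((b' - b) * (x / N)) * expo ((b' - b) * (l / N)) := by
    intro l
    rw [Complex.ofReal_pow, ← Complex.conj_mul', mask, map_mul, map_sum, map_inv₀,
      Complex.conj_natCast, mul_mul_mul_comm, Finset.sum_mul_sum]
    congr 1
    refine Finset.sum_congr rfl fun b _ => Finset.sum_congr rfl fun b' _ => ?_
    rw [conj_expo, ← expo_add, ← expo_add]
    congr 1
    field_simp
    ring
  have hc : ((∑ l ∈ L, ‖mask B ((x + l) / N)‖ ^ 2 : ℝ) : ℂ) = 1 := by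
    rw [Complex.ofReal_sum, Finset.sum_congr rfl fun l _ => hterm l, ← Finset.mul_sum,
      Finset.sum_comm, Finset.sum_congr rfl fun b _ => Finset.sum_comm]
    simp_rw [← Finset.mul_sum]
    rw [Finset.sum_congr rfl fun b hb => Finset.sum_congr rfl fun b' hb' => by
      rw [horth b hb b' hb']]
    simp only [mul_ite, mul_zero, Finset.sum_ite_eq, sub_self, zero_mul, expo_zero, one_mul]
    rw [Finset.sum_congr rfl fun b hb => if_pos hb, Finset.sum_const, nsmul_eq_mul]
    field_simp
  exact_mod_cast hc

/-- `Λ` is complete for `G` when `∑_{l ∈ Λ} |G (ξ + l)|² = 1` for all `ξ`. -/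
def IsCompleteFor (G : ℝ → ℂ) (Λ : Finset ℤ) : Prop :=
  ∀ ξ : ℝ, ∑ l ∈ Λ, ‖G (ξ + l)‖ ^ 2 = 1

/-- Injectivity of `f` comes for free: two indices with the same image would each contribute 1 at `ξ
= -f i`, making the sum at least 2. -/
theorem isCompleteFor_image {ι : Type*} {G : ℝ → ℂ} (hG : G 0 = 1) (s : Finset ι) (f : ι → ℤ)
    (h : ∀ ξ : ℝ, ∑ i ∈ s, ‖G (ξ + f i)‖ ^ 2 = 1) : IsCompleteFor G (s.image f) := by
  classical
  have hinj : Set.InjOn f s := by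
    intro i hi j hj hij
    by_contra hne
    have h1 := h (-(f i : ℝ))
    have h2 : ∑ k ∈ ({i, j} : Finset ι), ‖G (-(f i : ℝ) + f k)‖ ^ 2
        ≤ ∑ k ∈ s, ‖G (-(f i : ℝ) + f k)‖ ^ 2 :=
      Finset.sum_le_sum_of_subset_of_nonneg
        (Finset.insert_subset hi (Finset.singleton_subset_iff.2 hj)) fun _ _ _ => by positivity
    rw [h1, Finset.sum_pair hne, ← hij] at h2
    simp [hG] at h2
    norm_num at h2
  intro ξ
  rw [Finset.sum_image hinj, h]

theorem IsCompleteFor.exists_extend_succ {N : ℕ → ℕ} {B L : ℕ → Finset ℤ}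
    (hHad : ∀ n, IsHadamardTriple (N n) (B n) (L n)) {n : ℕ} {Λ : Finset ℤ}
    (h : IsCompleteFor (headCf N B n) Λ) :
    ∃ Λ', Λ ⊆ Λ' ∧ IsCompleteFor (headCf N B (n + 1)) Λ' := by
  have hN := fun n => (hHad n).two_le
  obtain ⟨l₀, hl₀⟩ : (L n).Nonempty := by
    rw [← Finset.card_pos, (hHad n).card_eq]; exact (hHad n).nonempty.card_pos
  -- Subtracting `l₀` puts the zero shift among the translates, so that `Λ` is kept.
  refine ⟨(Λ ×ˢ L n).image fun p => p.1 + scale N n * (p.2 - l₀), fun l hl => ?_,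
    isCompleteFor_image (headCf_zero_right N (fun n => (hHad n).nonempty) _) _ _ fun ξ => ?_⟩
  · exact Finset.mem_image.2 ⟨(l, l₀), Finset.mk_mem_product hl hl₀, by simp⟩
  · rw [Finset.sum_product, ← h ξ]
    refine Finset.sum_congr rfl fun l _ => ?_
    have hp := (scale_pos hN n).ne'
    rw [← mul_one (‖headCf N B n (ξ + l)‖ ^ 2),
      ← (hHad n).sum_norm_mask_sq ((ξ + l) / scale N n - l₀), Finset.mul_sum]
    refine Finset.sum_congr rfl fun m _ => ?_
    have e1 : ξ + ((l + scale N n * (m - l₀) : ℤ) : ℝ)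
        = ξ + l + scale N n * ((m - l₀ : ℤ) : ℝ) := by push_cast; ring
    have hN0 : (N n : ℝ) ≠ 0 := by have := hN n; positivity
    rw [e1, ← mul_pow, ← norm_mul, headCf, Finset.prod_range_succ, ← headCf,
      headCf_add_scale_mul hN, scale_succ]
    congr 4
    push_cast
    field_simp
    ring

theorem IsCompleteFor.exists_extend {N : ℕ → ℕ} {B L : ℕ → Finset ℤ}
    (hHad : ∀ n, IsHadamardTriple (N n) (B n) (L n)) {n m : ℕ} (hnm : n ≤ m) {Λ : Finset ℤ}
    (h : IsCompleteFor (headCf N B n) Λ) :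
    ∃ Λ', Λ ⊆ Λ' ∧ IsCompleteFor (headCf N B m) Λ' := by
  induction m, hnm using Nat.le_induction with
  | base => exact ⟨Λ, subset_rfl, h⟩
  | succ m _ ih =>
    obtain ⟨Λ₁, h1, h2⟩ := ih
    obtain ⟨Λ₂, h3, h4⟩ := h2.exists_extend_succ hHad
    exact ⟨Λ₂, h1.trans h3, h4⟩

theorem isCompleteFor_headCf_zero (N : ℕ → ℕ) (B : ℕ → Finset ℤ) :
    IsCompleteFor (headCf N B 0) {0} := by
  intro ξ; simp [headCf]

/-- Extension of `Λ` keeping the tail of the Fourier transform bounded away from zero. -/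
theorem IsCompleteFor.exists_extend_tail {N : ℕ → ℕ} {B L : ℕ → Finset ℤ}
    (hHad : ∀ n, IsHadamardTriple (N n) (B n) (L n)) {n m : ℕ} (hnm : n ≤ m) {Λ : Finset ℤ}
    (h : IsCompleteFor (headCf N B n) Λ) {ε : ℝ} {F : ℝ → ℂ}
    (hF : ∀ x : ℝ, ∃ k : ℤ, ε ≤ ‖F (x + k)‖) (hΛ : ∀ l ∈ Λ, ε ≤ ‖F (l / scale N m)‖) :
    ∃ Λ', Λ ⊆ Λ' ∧ IsCompleteFor (headCf N B m) Λ' ∧ ∀ l ∈ Λ', ε ≤ ‖F (l / scale N m)‖ := by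
  have hN := fun n => (hHad n).two_le
  obtain ⟨Λ₁, h1, h2⟩ := h.exists_extend hHad hnm
  -- Old frequencies stay in place, to keep the sets nested; only new ones are moved by a period of
  -- the head.
  have hk : ∀ l : ℤ, ∃ k : ℤ, ε ≤ ‖F (l / scale N m + k)‖ ∧ (l ∈ Λ → k = 0) := by
    intro l
    by_cases hl : l ∈ Λ
    · exact ⟨0, by simpa using hΛ l hl, fun _ => rfl⟩
    · obtain ⟨k, hk⟩ := hF (l / scale N m)
      exact ⟨k, hk, fun h => absurd h hl⟩
  choose k hk hk0 using hk
  refine ⟨Λ₁.image fun l => l + scale N m * k l, fun l hl => ?_,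
    isCompleteFor_image (headCf_zero_right N (fun n => (hHad n).nonempty) _) _ _ fun ξ => ?_,
    fun l hl => ?_⟩
  · exact Finset.mem_image.2 ⟨l, h1 hl, by simp [hk0 l hl]⟩
  · rw [← h2 ξ]
    refine Finset.sum_congr rfl fun l _ => ?_
    rw [← headCf_add_scale_mul hN B m (ξ + l) (k l)]
    push_cast
    ring_nf
  · obtain ⟨l, _, rfl⟩ := Finset.mem_image.1 hl
    have hp := (scale_pos hN m).ne'
    convert hk l using 3
    push_cast
    field_simp

/-! ### Nested complete sets and passage to the limit. -/

theorem tendsto_scale_atTop {N : ℕ → ℕ} (hN : ∀ n, 2 ≤ N n) :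
    Tendsto (fun n => (scale N n : ℝ)) atTop atTop := by
  refine tendsto_atTop_mono (fun n => ?_)
    (tendsto_pow_atTop_atTop_of_one_lt (one_lt_two : (1 : ℝ) < 2))
  exact_mod_cast two_pow_le_scale hN n

theorem eventually_norm_cf_nuTail_sub_le {N : ℕ → ℕ} {B : ℕ → Finset ℤ} (hN : ∀ n, 2 ≤ N n)
    (hB : ∀ n, (B n).Nonempty) (hBN : ∀ n, B n ⊆ Finset.Ico 0 (N n : ℤ)) (ξ : ℝ) {ε : ℝ}
    (hε : 0 < ε) : ∀ᶠ n in atTop, ∀ η : ℝ,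
      ‖cf (nuTail N B n) ((ξ + η) / scale N n) - cf (nuTail N B n) (η / scale N n)‖ ≤ ε := by
  have h : Tendsto (fun n => 2 * Real.pi * |ξ| / (scale N n : ℝ)) atTop (𝓝 0) :=
    tendsto_const_nhds.div_atTop (tendsto_scale_atTop hN)
  filter_upwards [h.eventually_le_const hε] with n hn η
  refine (norm_cf_nuTail_sub_le hN hB hBN n _ _).trans (le_trans (le_of_eq ?_) hn)
  rw [← sub_div, add_sub_cancel_right, abs_div, abs_of_pos (scale_pos hN n), mul_div_assoc]

/-- A strictly increasing sequence of levels with nested complete sets, along which the tails of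
the Fourier transform are bounded away from zero. -/
theorem exists_nested_complete {N : ℕ → ℕ} {B L : ℕ → Finset ℤ}
    (hHad : ∀ n, IsHadamardTriple (N n) (B n) (L n))
    (hBN : ∀ n, B n ⊆ Finset.Ico 0 (N n : ℤ)) {ε : ℝ} (hε : ε ≤ 1 / 2)
    (hpos : ∃ᶠ n in atTop, ∀ x : ℝ, ∃ k : ℤ, ε ≤ ‖cf (nuTail N B n) (x + k)‖) :
    ∃ (m : ℕ → ℕ) (Λ : ℕ → Finset ℤ), StrictMono m ∧ Monotone Λ ∧
      ∀ j, IsCompleteFor (headCf N B (m j)) (Λ j) ∧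
        ∀ l ∈ Λ j, ε ≤ ‖cf (nuTail N B (m j)) (l / scale N (m j))‖ := by
  have hN := fun n => (hHad n).two_le
  have hB := fun n => (hHad n).nonempty
  have hprob := isProbabilityMeasure_nuTail hN hB hBN
  let Good : ℕ × Finset ℤ → Prop := fun p => IsCompleteFor (headCf N B p.1) p.2 ∧
    ∀ l ∈ p.2, ε ≤ ‖cf (nuTail N B p.1) (l / scale N p.1)‖
  have hstep : ∀ s : {p // Good p}, ∃ s' : {p // Good p},
      s.1.1 < s'.1.1 ∧ s.1.2 ⊆ s'.1.2 := by
    rintro ⟨⟨n, Λ⟩, hc, -⟩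
    -- `Λ` is finite, so its rescaled points tend to 0, where the transform equals 1; eventually its
    -- modulus there is at least `1/2 ≥ ε`.
    have hev : ∀ᶠ m in atTop, n < m ∧ ∀ l ∈ Λ, ε ≤ ‖cf (nuTail N B m) (l / scale N m)‖ := by
      refine (eventually_gt_atTop n).and
        ((Finset.eventually_all Λ).2 fun l _ => ?_)
      filter_upwards [eventually_norm_cf_nuTail_sub_le hN hB hBN l one_half_pos] with m hm
      have h := hm 0
      have := hprob m
      rw [add_zero, zero_div, cf_zero, norm_sub_rev] at h
      have h' := norm_sub_norm_le (1 : ℂ) (cf (nuTail N B m) (l / scale N m))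
      rw [norm_one] at h'
      linarith
    obtain ⟨m, hm, hnm, hΛ⟩ := (hpos.and_eventually hev).exists
    obtain ⟨Λ', h1, h2, h3⟩ := hc.exists_extend_tail hHad hnm.le hm hΛ
    exact ⟨⟨(m, Λ'), h2, h3⟩, hnm, h1⟩
  choose next hlt hsub using hstep
  have h0 : Good (0, {0}) := by
    have := hprob 0
    refine ⟨isCompleteFor_headCf_zero N B, fun l hl => ?_⟩
    rw [Finset.mem_singleton.1 hl, Int.cast_zero, zero_div, cf_zero, norm_one]
    linarith
  let s : ℕ → {p // Good p} := fun j => next^[j] ⟨(0, {0}), h0⟩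
  have hs : ∀ j, s (j + 1) = next (s j) := fun j => Function.iterate_succ_apply' _ _ _
  refine ⟨fun j => (s j).1.1, fun j => (s j).1.2, strictMono_nat_of_lt_succ fun j => ?_,
    monotone_nat_of_le_succ fun j => ?_, fun j => (s j).2⟩
  · rw [hs]; exact hlt _
  · rw [hs]; exact hsub _

theorem exists_hasSum_norm_cf_sq {N : ℕ → ℕ} {B L : ℕ → Finset ℤ}
    (hHad : ∀ n, IsHadamardTriple (N n) (B n) (L n))
    (hBN : ∀ n, B n ⊆ Finset.Ico 0 (N n : ℤ)) {ε : ℝ} (hε0 : 0 < ε) (hε : ε ≤ 1 / 2)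
    (hpos : ∃ᶠ n in atTop, ∀ x : ℝ, ∃ k : ℤ, ε ≤ ‖cf (nuTail N B n) (x + k)‖) :
    ∃ S : Set ℤ, ∀ ξ : ℝ, HasSum (fun l : S => ‖cf (cantorMoran N B) (ξ + (l : ℤ))‖ ^ 2) 1 := by
  classical
  have hN := fun n => (hHad n).two_le
  have hB := fun n => (hHad n).nonempty
  have hprob := isProbabilityMeasure_nuTail hN hB hBN
  obtain ⟨m, Λ, hm, hΛ, hgood⟩ := exists_nested_complete hHad hBN hε hpos
  set μ := cantorMoran N B
  let S : Set ℤ := ⋃ j, (Λ j : Set ℤ)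
  refine ⟨S, fun ξ => ?_⟩
  have hle : ∀ j (l : ℤ), ‖cf μ (ξ + l)‖ ≤ ‖headCf N B (m j) (ξ + l)‖ := by
    intro j l
    have := hprob (m j)
    rw [cf_cantorMoran hN hB hBN (m j), norm_mul]
    exact mul_le_of_le_one_right (norm_nonneg _) (norm_charFun_le_one _)
  let g : S → ℝ := fun l => ‖cf μ (ξ + (l : ℤ))‖ ^ 2
  have hg0 : ∀ l, 0 ≤ g l := fun l => by positivity
  have hsum : Summable g := by
    refine summable_of_sum_le (c := 1) hg0 fun u => ?_
    have hev : ∀ᶠ j in atTop, ∀ l ∈ u, (l : ℤ) ∈ Λ j := by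
      refine (Finset.eventually_all u).2 fun l _ => ?_
      obtain ⟨i, hi⟩ := Set.mem_iUnion.1 l.2
      filter_upwards [eventually_ge_atTop i] with j hj using hΛ hj hi
    obtain ⟨j, hj⟩ := hev.exists
    calc ∑ l ∈ u, g l = ∑ l ∈ u.image (fun l : S => (l : ℤ)), ‖cf μ (ξ + l)‖ ^ 2 := by
          rw [Finset.sum_image Subtype.val_injective.injOn]
      _ ≤ ∑ l ∈ Λ j, ‖cf μ (ξ + l)‖ ^ 2 :=
          Finset.sum_le_sum_of_subset_of_nonneg (Finset.image_subset_iff.2 hj)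
            fun _ _ _ => by positivity
      _ ≤ ∑ l ∈ Λ j, ‖headCf N B (m j) (ξ + l)‖ ^ 2 :=
          Finset.sum_le_sum fun l _ => by gcongr; exact hle j l
      _ = 1 := (hgood j).1 ξ
  let f : ℕ → S → ℝ := fun j l =>
    if (l : ℤ) ∈ Λ j then ‖headCf N B (m j) (ξ + (l : ℤ))‖ ^ 2 else 0
  have hf1 : ∀ j, ∑' l, f j l = 1 := by
    intro j
    have hin : ∀ l ∈ Λ j, l ∈ S := fun l hl => Set.mem_iUnion.2 ⟨j, hl⟩
    have h1 : ∑' l, f j l = ∑' l : ℤ, if l ∈ Λ j then ‖headCf N B (m j) (ξ + l)‖ ^ 2 else 0 := by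
      refine (tsum_subtype_eq_of_support_subset
        (f := fun l : ℤ => if l ∈ Λ j then ‖headCf N B (m j) (ξ + l)‖ ^ 2 else 0) ?_)
      intro l hl
      by_contra hlS
      exact hl (if_neg fun h => hlS (hin l h))
    rw [h1, tsum_eq_sum (s := Λ j) fun l hl => if_neg hl, ← (hgood j).1 ξ]
    exact Finset.sum_congr rfl fun l hl => if_pos hl
  have hlim : Tendsto (fun j => ∑' l, f j l) atTop (𝓝 (∑' l, g l)) := by
    -- On `Λ j` the tail is at least `ε` at `l`, hence at least `ε / 2` at `ξ + l` for large `j`;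
    -- dividing by it bounds the head by `2 / ε` times the full transform.
    refine tendsto_tsum_of_dominated_convergence (bound := fun l => (2 / ε) ^ 2 * g l)
      (hsum.mul_left _) (fun l => ?_) ?_
    · obtain ⟨i, hi⟩ := Set.mem_iUnion.1 l.2
      have h1 := ((tendsto_headCf hN hB hBN (ξ + (l : ℤ))).comp hm.tendsto_atTop).norm.pow 2
      refine h1.congr' ?_
      filter_upwards [eventually_ge_atTop i] with j hj
      simp [f, show (l : ℤ) ∈ Λ j from hΛ hj hi]
    · filter_upwards [hm.tendsto_atTop.eventually
        (eventually_norm_cf_nuTail_sub_le hN hB hBN ξ (half_pos hε0))] with j hj l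
      by_cases hl : (l : ℤ) ∈ Λ j
      · have h1 := (hgood j).2 l hl
        have h2 := hj (l : ℤ)
        have h3 : ε / 2 ≤ ‖cf (nuTail N B (m j)) ((ξ + (l : ℤ)) / scale N (m j))‖ := by
          rw [norm_sub_rev] at h2
          have h4 := norm_sub_norm_le (cf (nuTail N B (m j)) ((l : ℤ) / scale N (m j)))
            (cf (nuTail N B (m j)) ((ξ + (l : ℤ)) / scale N (m j)))
          linarith
        have h5 : ‖headCf N B (m j) (ξ + (l : ℤ))‖ ≤ 2 / ε * ‖cf μ (ξ + (l : ℤ))‖ := by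
          rw [cf_cantorMoran hN hB hBN (m j), norm_mul]
          calc _ = 2 / ε * (‖headCf N B (m j) (ξ + (l : ℤ))‖ * (ε / 2)) := by field_simp
            _ ≤ _ := by gcongr
        simp only [f, if_pos hl, g, ← mul_pow]
        rw [Real.norm_of_nonneg (by positivity)]
        gcongr
      · simp only [f, if_neg hl, norm_zero]
        have := hg0 l
        positivity
  simp only [hf1] at hlim
  rw [tendsto_nhds_unique tendsto_const_nhds hlim]
  exact hsum.hasSum

/-! ### From Parseval for exponentials to an orthonormal basis of `L²(μ)`. -/

theorem memLp_expo (μ : Measure ℝ) [IsFiniteMeasure μ] (ξ : ℝ) :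
    MemLp (fun x => expo (ξ * x)) 2 μ :=
  MemLp.of_bound (continuous_expo.comp (by fun_prop)).aestronglyMeasurable 1
    (ae_of_all _ fun _ => (norm_expo _).le)

/-- The exponential `x ↦ exp (2πiξx)` as an element of `L²(μ)`. -/
def expLp (μ : Measure ℝ) [IsFiniteMeasure μ] (ξ : ℝ) : Lp ℂ 2 μ := (memLp_expo μ ξ).toLp _

theorem coeFn_expLp (μ : Measure ℝ) [IsFiniteMeasure μ] (ξ : ℝ) :
    (expLp μ ξ : ℝ → ℂ) =ᵐ[μ] fun x => expo (ξ * x) := (memLp_expo μ ξ).coeFn_toLp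

theorem inner_expLp (μ : Measure ℝ) [IsFiniteMeasure μ] (s t : ℝ) :
    inner ℂ (expLp μ s) (expLp μ t) = cf μ (t - s) := by
  rw [L2.inner_def, cf_eq_integral]
  refine integral_congr_ae ?_
  filter_upwards [coeFn_expLp μ s, coeFn_expLp μ t] with x h1 h2
  rw [h1, h2, RCLike.inner_apply, conj_expo, ← expo_add]
  ring_nf

theorem norm_expLp (μ : Measure ℝ) [IsProbabilityMeasure μ] (s : ℝ) : ‖expLp μ s‖ = 1 := by
  have h := inner_self_eq_norm_sq_to_K (𝕜 := ℂ) (expLp μ s)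
  rw [inner_expLp, sub_self, cf_zero] at h
  have h2 : ‖expLp μ s‖ ^ 2 = 1 := by
    have : ((‖expLp μ s‖ ^ 2 : ℝ) : ℂ) = 1 := by rw [h]; simp
    exact_mod_cast this
  exact (pow_eq_one_iff_of_nonneg (norm_nonneg _) two_ne_zero).1 h2

/-- The positive and negative parts of `u` are densities of two finite measures with the same
characteristic function, hence agree almost everywhere. -/
theorem ae_eq_zero_of_integral_mul_expo_real {μ : Measure ℝ} [IsFiniteMeasure μ] {u : ℝ → ℝ}
    (hu : Integrable u μ) (h : ∀ ξ : ℝ, ∫ x, (u x : ℂ) * expo (ξ * x) ∂μ = 0) :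
    u =ᵐ[μ] 0 := by
  wlog hum : Measurable u generalizing u
  · have hae := hu.aestronglyMeasurable.ae_eq_mk
    refine hae.trans (this (hu.congr hae) (fun ξ => ?_)
      hu.aestronglyMeasurable.stronglyMeasurable_mk.measurable)
    rw [← h ξ]
    refine integral_congr_ae ?_
    filter_upwards [hae] with x hx
    rw [hx]
  have hpf : ∫⁻ x, ENNReal.ofReal (u x) ∂μ ≠ ⊤ := hu.lintegral_lt_top.ne
  have hnf : ∫⁻ x, ENNReal.ofReal (-u x) ∂μ ≠ ⊤ := hu.neg.lintegral_lt_top.ne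
  have hpm : Measurable fun x => ENNReal.ofReal (u x) := hum.ennreal_ofReal
  have hnm : Measurable fun x => ENNReal.ofReal (-u x) := hum.neg.ennreal_ofReal
  have := isFiniteMeasure_withDensity hpf
  have := isFiniteMeasure_withDensity hnf
  have hbdd : ∀ ξ {v : ℝ → ℝ}, Integrable v μ →
      Integrable (fun x => (v x : ℂ) * expo (ξ * x)) μ := fun ξ v hv =>
    hv.ofReal.mul_bdd (c := 1) (continuous_expo.comp (by fun_prop)).aestronglyMeasurable
      (ae_of_all _ fun _ => (norm_expo _).le)
  have heq : μ.withDensity (fun x => ENNReal.ofReal (u x))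
      = μ.withDensity (fun x => ENNReal.ofReal (-u x)) := by
    refine Measure.ext_of_charFun (funext fun t => ?_)
    obtain ⟨ξ, rfl⟩ : ∃ ξ, t = 2 * Real.pi * ξ :=
      ⟨t / (2 * Real.pi), by have := Real.pi_pos; field_simp⟩
    change cf _ ξ = cf _ ξ
    rw [cf_eq_integral, cf_eq_integral,
      integral_withDensity_eq_integral_toReal_smul hpm (ae_of_all _ fun _ => ENNReal.ofReal_lt_top),
      integral_withDensity_eq_integral_toReal_smul hnm (ae_of_all _ fun _ => ENNReal.ofReal_lt_top),
      ← sub_eq_zero]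
    simp only [ENNReal.toReal_ofReal', Complex.real_smul]
    rw [← integral_sub (hbdd ξ hu.pos_part) (hbdd ξ hu.neg_part), ← h ξ]
    refine integral_congr_ae (ae_of_all _ fun x => ?_)
    beta_reduce
    rw [← sub_mul, ← Complex.ofReal_sub]
    congr 2
    rcases le_total 0 (u x) with h | h
    · simp [h]
    · simp [h]
  filter_upwards [(withDensity_eq_iff hpm.aemeasurable hnm.aemeasurable hpf).1 heq] with x hx
  rcases le_total 0 (u x) with h | h
  · rw [ENNReal.ofReal_of_nonpos (neg_nonpos.2 h), ENNReal.ofReal_eq_zero] at hx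
    exact le_antisymm hx h
  · rw [ENNReal.ofReal_of_nonpos h, eq_comm, ENNReal.ofReal_eq_zero] at hx
    exact le_antisymm h (neg_nonpos.1 hx)

theorem ae_eq_zero_of_integral_mul_expo {μ : Measure ℝ} [IsFiniteMeasure μ] {f : ℝ → ℂ}
    (hf : Integrable f μ) (h : ∀ ξ : ℝ, ∫ x, f x * expo (ξ * x) ∂μ = 0) : f =ᵐ[μ] 0 := by
  have hbdd : ∀ ξ {v : ℝ → ℂ}, Integrable v μ →
      Integrable (fun x => v x * expo (ξ * x)) μ := fun ξ v hv =>
    hv.mul_bdd (c := 1) (continuous_expo.comp (by fun_prop)).aestronglyMeasurable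
      (ae_of_all _ fun _ => (norm_expo _).le)
  -- The transform of the conjugate vanishes as well, by `ξ ↦ -ξ`; the real and imaginary parts are
  -- then covered by the real case.
  have hfc : Integrable (fun x => (starRingEnd ℂ) (f x)) μ :=
    (Complex.conjCLE : ℂ →L[ℝ] ℂ).integrable_comp hf
  have hconj : ∀ ξ : ℝ, ∫ x, (starRingEnd ℂ) (f x) * expo (ξ * x) ∂μ = 0 := by
    intro ξ
    have h1 := congrArg (starRingEnd ℂ) (h (-ξ))
    rw [← integral_conj, map_zero] at h1
    rw [← h1]
    refine integral_congr_ae (ae_of_all _ fun x => ?_)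
    simp only [map_mul, conj_expo]
    ring_nf
  have hre : (fun x => (f x).re) =ᵐ[μ] 0 := by
    refine ae_eq_zero_of_integral_mul_expo_real hf.re fun ξ => ?_
    have h2 := integral_add (hbdd ξ hf) (hbdd ξ hfc)
    rw [h, hconj, add_zero] at h2
    have h3 : ∀ x, ((f x).re : ℂ) * expo (ξ * x)
        = (1 / 2 : ℂ) * (f x * expo (ξ * x) + (starRingEnd ℂ) (f x) * expo (ξ * x)) := by
      intro x; rw [Complex.re_eq_add_conj]; ring
    simp_rw [h3]
    rw [integral_const_mul, h2, mul_zero]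
  have him : (fun x => (f x).im) =ᵐ[μ] 0 := by
    refine ae_eq_zero_of_integral_mul_expo_real hf.im fun ξ => ?_
    have h2 := integral_sub (hbdd ξ hf) (hbdd ξ hfc)
    rw [h, hconj, sub_zero] at h2
    have h3 : ∀ x, ((f x).im : ℂ) * expo (ξ * x)
        = (1 / (2 * Complex.I) : ℂ)
          * (f x * expo (ξ * x) - (starRingEnd ℂ) (f x) * expo (ξ * x)) := by
      intro x; rw [Complex.im_eq_sub_conj]; ring
    simp_rw [h3]
    rw [integral_const_mul, h2, mul_zero]
  filter_upwards [hre, him] with x h1 h2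
  exact Complex.ext h1 h2

theorem eq_zero_of_forall_inner_expLp {μ : Measure ℝ} [IsProbabilityMeasure μ] {f : Lp ℂ 2 μ}
    (h : ∀ ξ : ℝ, inner ℂ (expLp μ ξ) f = 0) : f = 0 := by
  rw [Lp.eq_zero_iff_ae_eq_zero]
  refine ae_eq_zero_of_integral_mul_expo ((Lp.memLp f).integrable one_le_two) fun ξ => ?_
  rw [← h (-ξ), L2.inner_def]
  refine integral_congr_ae ?_
  filter_upwards [coeFn_expLp μ (-ξ)] with x hx
  rw [hx, RCLike.inner_apply, conj_expo, neg_mul, neg_neg]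

/-- If `x` realizes equality in Bessel's inequality, then every vector orthogonal to the system is
orthogonal to `x`. -/
theorem inner_eq_zero_of_hasSum {ι E : Type*} [NormedAddCommGroup E] [InnerProductSpace ℂ E]
    {v : ι → E} (hv : Orthonormal ℂ v) {x : E}
    (hx : HasSum (fun i => ‖inner ℂ (v i) x‖ ^ 2) (‖x‖ ^ 2)) {f : E}
    (hf : ∀ i, inner ℂ (v i) f = 0) : inner ℂ x f = 0 := by
  classical
  have hlim : Tendsto (fun s : Finset ι => Real.sqrt (‖x‖ ^ 2 - ∑ i ∈ s, ‖inner ℂ (v i) x‖ ^ 2)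
      * ‖f‖) atTop (𝓝 0) := by
    have h1 := (Real.continuous_sqrt.tendsto _).comp (hx.const_sub (‖x‖ ^ 2))
    simpa using h1.mul_const ‖f‖
  -- With `y` the projection of `x` to the span of `v i`, `i ∈ s`, the product with `f` is unchanged
  -- when `x` is replaced by `x - y`; the norm of `x - y` is the vanishing square root.
  refine norm_le_zero_iff.1 (ge_of_tendsto hlim (Eventually.of_forall fun s => ?_))
  set y := ∑ i ∈ s, inner ℂ (v i) x • v i
  have hyf : inner ℂ y f = 0 := by
    rw [sum_inner]
    exact Finset.sum_eq_zero fun i _ => by rw [inner_smul_left, hf, mul_zero]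
  have hyy : inner ℂ y y = ((∑ i ∈ s, ‖inner ℂ (v i) x‖ ^ 2 : ℝ) : ℂ) := by
    rw [hv.inner_sum]
    push_cast
    exact Finset.sum_congr rfl fun i _ => Complex.conj_mul' _
  have hyx : inner ℂ y x = ((∑ i ∈ s, ‖inner ℂ (v i) x‖ ^ 2 : ℝ) : ℂ) := by
    rw [sum_inner]
    push_cast
    refine Finset.sum_congr rfl fun i _ => ?_
    rw [inner_smul_left, Complex.conj_mul']
  have hnorm : ‖x - y‖ ^ 2 = ‖x‖ ^ 2 - ∑ i ∈ s, ‖inner ℂ (v i) x‖ ^ 2 := by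
    have hy2 : ‖y‖ ^ 2 = ∑ i ∈ s, ‖inner ℂ (v i) x‖ ^ 2 := by
      rw [← inner_self_eq_norm_sq (𝕜 := ℂ), hyy]; exact Complex.ofReal_re _
    rw [norm_sub_sq (𝕜 := ℂ), hy2, inner_re_symm, hyx]
    simp only [RCLike.re_to_complex, Complex.ofReal_re]
    ring
  rw [← hnorm, Real.sqrt_sq (norm_nonneg _)]
  calc ‖inner ℂ x f‖ = ‖inner ℂ (x - y) f‖ := by rw [inner_sub_left, hyf, sub_zero]
    _ ≤ _ := norm_inner_le_norm _ _

theorem isSpectralMeasure_of_hasSum {μ : Measure ℝ} [IsProbabilityMeasure μ] {Λ : Set ℝ}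
    (hΛ : Λ.Countable) (h : ∀ ξ : ℝ, HasSum (fun l : Λ => ‖cf μ (ξ - l)‖ ^ 2) 1) :
    IsSpectralMeasure μ := by
  classical
  have horth : Orthonormal ℂ fun l : Λ => expLp μ l := by
    refine ⟨fun l => norm_expLp μ l, fun a b hab => ?_⟩
    -- At `ξ = b` the term `l = b` already exhausts the sum, so all others vanish.
    have h1 := sum_le_hasSum {b, a} (fun _ _ => by positivity) (h b)
    rw [Finset.sum_pair hab.symm, sub_self, cf_zero, norm_one] at h1
    change inner ℂ (expLp μ a) (expLp μ b) = 0
    rw [inner_expLp]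
    have h2 : ‖cf μ ((b : ℝ) - a)‖ ^ 2 ≤ 0 := by linarith
    exact norm_eq_zero.1 (pow_eq_zero_iff two_ne_zero |>.1 (le_antisymm h2 (by positivity)))
  have hspan : ⊤ ≤ (Submodule.span ℂ (Set.range fun l : Λ => expLp μ l)).topologicalClosure := by
    rw [top_le_iff, Submodule.topologicalClosure_eq_top_iff, Submodule.eq_bot_iff]
    intro f hf
    refine eq_zero_of_forall_inner_expLp fun ξ => ?_
    refine inner_eq_zero_of_hasSum horth ?_ fun l =>
      (Submodule.mem_orthogonal _ _).1 hf _ (Submodule.subset_span ⟨l, rfl⟩)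
    simpa only [inner_expLp, norm_expLp, one_pow] using h ξ
  refine ⟨inferInstance, Λ, hΛ, HilbertBasis.mk horth hspan, fun l => ?_⟩
  rw [HilbertBasis.coe_mk]
  filter_upwards [coeFn_expLp μ l] with x hx
  rw [hx, expo]
  push_cast
  ring_nf

/-! ### The limit measure and uniform convergence of transforms. -/

instance isFiniteMeasure_rho : IsFiniteMeasure rho := by
  constructor
  rw [rho, Measure.smul_apply, smul_eq_mul]
  exact ENNReal.mul_lt_top (by simp) (measure_lt_top _ _)

theorem cf_rho (ξ : ℝ) : cf rho ξ = (1 + expo ξ) / 2 := by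
  rw [cf_eq_integral, rho, integral_smul_measure,
    integral_add_measure (integrable_expo _ _) (integrable_expo _ _), integral_dirac,
    integral_dirac]
  simp [expo_zero]
  ring

/-- The modulus is `|cos πx|`, which lies above its chords on `[0, 1/2]` and `[1/2, 1]`. -/
theorem abs_one_sub_two_mul_le_norm_cf_rho {x : ℝ} (h0 : 0 ≤ x) (h1 : x ≤ 1) :
    |1 - 2 * x| ≤ ‖cf rho x‖ := by
  have hcos : ‖cf rho x‖ = |Real.cos (Real.pi * x)| := by
    have h : cf rho x = expo (x / 2) * (Real.cos (Real.pi * x) : ℂ) := by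
      have e1 : ((Real.cos (Real.pi * x) : ℝ) : ℂ) = (expo (x / 2) + expo (-(x / 2))) / 2 := by
        rw [Complex.ofReal_cos, Complex.cos, expo, expo]
        push_cast
        ring_nf
      rw [cf_rho, e1, mul_div_assoc', mul_add, ← expo_add, ← expo_add, add_neg_cancel,
        add_halves, expo_zero, add_comm]
    rw [h, norm_mul, norm_expo, one_mul, Complex.norm_real, Real.norm_eq_abs]
  rw [hcos]
  have hpi := Real.pi_pos
  have key : ∀ y : ℝ, 0 ≤ y → y ≤ 1 / 2 → |1 - 2 * y| ≤ |Real.cos (Real.pi * y)| := by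
    intro y hy0 hy1
    have h := Real.one_sub_mul_le_cos (x := Real.pi * y) (by positivity) (by nlinarith)
    rw [abs_of_nonneg (by linarith)]
    refine le_trans (le_of_eq ?_) (h.trans (le_abs_self _))
    field_simp
  rcases le_total x (1 / 2) with hx | hx
  · exact key x h0 hx
  · have h := key (1 - x) (by linarith) (by linarith)
    rw [mul_sub Real.pi, mul_one, Real.cos_pi_sub, abs_neg] at h
    rwa [← abs_neg, show -(1 - 2 * x) = 1 - 2 * (1 - x) by ring]

/-- On `[0, 1]`, pointwise convergence of uniformly Lipschitz functions is uniform. -/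
theorem eventually_forall_norm_sub_le_of_lipschitz {F : ℕ → ℝ → ℂ} {G : ℝ → ℂ} {K : ℝ}
    (hK : 0 < K) (hF : ∀ n s t, ‖F n s - F n t‖ ≤ K * |s - t|)
    (hlim : ∀ x, Tendsto (fun n => F n x) atTop (𝓝 (G x))) {ε : ℝ} (hε : 0 < ε) :
    ∀ᶠ n in atTop, ∀ x ∈ Set.Icc (0 : ℝ) 1, ‖F n x - G x‖ ≤ ε := by
  have hG : ∀ s t, ‖G s - G t‖ ≤ K * |s - t| := fun s t =>
    le_of_tendsto ((hlim s).sub (hlim t)).norm (Eventually.of_forall fun n => hF n s t)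
  have hη : 0 < ε / (3 * K) := by positivity
  obtain ⟨T, hTfin, hT⟩ := Metric.totallyBounded_iff.1
    (isCompact_Icc (a := (0 : ℝ)) (b := 1)).totallyBounded _ hη
  have hev : ∀ᶠ n in atTop, ∀ y ∈ T, ‖F n y - G y‖ < ε / 3 := by
    refine hTfin.eventually_all.2 fun y _ => ?_
    have := (tendsto_iff_norm_sub_tendsto_zero.1 (hlim y)).eventually_lt_const
      (show 0 < ε / 3 by positivity)
    exact this
  filter_upwards [hev] with n hn x hx
  obtain ⟨y, hy, hxy⟩ := Set.mem_iUnion₂.1 (hT hx)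
  rw [Metric.mem_ball, Real.dist_eq] at hxy
  have hb : K * |x - y| ≤ ε / 3 := by
    calc K * |x - y| ≤ K * (ε / (3 * K)) := by gcongr
      _ = ε / 3 := by field_simp
  have h1 := (hF n x y).trans hb
  have h2 := (hG x y).trans hb
  have h3 := hn y hy
  calc ‖F n x - G x‖ = ‖(F n x - F n y) + (F n y - G y) - (G x - G y)‖ := by congr 1; ring
    _ ≤ ‖F n x - F n y‖ + ‖F n y - G y‖ + ‖G x - G y‖ :=
      (norm_sub_le _ _).trans (by gcongr; exact norm_add_le _ _)
    _ ≤ ε := by linarith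

/-! ### Symmetric digit sets and sums of sines. -/

theorem mem_lowPart {N : ℕ} {B : Finset ℤ} (hBN : B ⊆ Finset.Ico 0 (N : ℤ)) {δ : ℝ} {b : ℤ} : b ∈ lowPart N B δ ↔ b ∈ B ∧ (b : ℝ) ≤ N * δ := by
  simp only [lowPart, nearEnds, Finset.mem_filter, Set.mem_Icc, Set.mem_Ioo, not_and, not_lt]
  constructor
  · rintro ⟨⟨h1, -⟩, -, h2⟩
    exact ⟨h1, h2⟩
  · rintro ⟨h1, h2⟩
    obtain ⟨h3, h4⟩ := Finset.mem_Ico.1 (hBN h1)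
    have hN : (0 : ℝ) < N := by exact_mod_cast h3.trans_lt h4
    refine ⟨⟨h1, fun h => ?_⟩, by exact_mod_cast h3, h2⟩
    rw [lt_div_iff₀ hN] at h
    linarith

/-- No digit has `b / N` strictly between `δ'` and `1 - δ'`. The sine hypothesis, given for one
fixed `δ`, can therefore be used with `δ'` as small as needed. -/
theorem lowPart_eq_of_eq_nearEnds {N : ℕ} {B : Finset ℤ} (hBN : B ⊆ Finset.Ico 0 (N : ℤ))
    {δ δ' : ℝ} (hle : δ' ≤ δ) (hδ : δ < 1 / 2) (h : B = nearEnds N B δ') :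
    lowPart N B δ = lowPart N B δ' := by
  ext b
  rw [mem_lowPart hBN, mem_lowPart hBN]
  refine and_congr_right fun hb => ⟨fun h1 => ?_, fun h1 => h1.trans (by gcongr)⟩
  obtain ⟨h3, h4⟩ := Finset.mem_Ico.1 (hBN hb)
  have hN : (0 : ℝ) < N := by exact_mod_cast h3.trans_lt h4
  rw [h, nearEnds, Finset.mem_filter] at hb
  by_contra h2
  refine hb.2 ⟨?_, ?_⟩
  · rw [lt_div_iff₀ hN]; linarith
  · rw [div_lt_iff₀ hN]; nlinarith

theorem sum_eq_of_symmetric {N : ℕ} {B : Finset ℤ} (hBN : B ⊆ Finset.Ico 0 (N : ℤ)) {δ : ℝ}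
    (hδ : δ < 1 / 2) (h : B = nearEnds N B δ)
    (hs : highPart N B δ = (lowPart N B δ).erase 0) {R : Type*} [AddCommMonoid R] (f : ℤ → R) :
    ∑ b ∈ B, f b = (if 0 ∈ lowPart N B δ then f 0 else 0)
      + ∑ c ∈ (lowPart N B δ).erase 0, (f c + f (N - c)) := by
  classical
  have hhigh : ∑ c ∈ highPart N B δ, f (N - c)
      = ∑ b ∈ B.filter (fun b => b ∉ lowPart N B δ), f b := by
    rw [highPart, Finset.sum_image fun a _ b _ hab => by simpa using hab]
    simp only [sub_sub_cancel]
    congr 1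
    ext b
    rw [Finset.mem_filter, Finset.mem_filter, ← h]
    refine and_congr_right fun hb => ?_
    obtain ⟨h3, h4⟩ := Finset.mem_Ico.1 (hBN hb)
    have hN : (0 : ℝ) < N := by exact_mod_cast h3.trans_lt h4
    rw [mem_lowPart hBN, Set.mem_Ico]
    constructor
    · rintro ⟨h1, -⟩ ⟨-, h2⟩
      nlinarith
    · intro h1
      have h2 : (N : ℝ) * δ < b := not_le.1 fun h => h1 ⟨hb, h⟩
      refine ⟨not_lt.1 fun h5 => ?_, by exact_mod_cast h4⟩
      rw [h, nearEnds, Finset.mem_filter] at hb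
      refine hb.2 ⟨?_, ?_⟩
      · rw [lt_div_iff₀ hN]; linarith
      · rw [div_lt_iff₀ hN]; linarith
  have hlow : B.filter (fun b => b ∈ lowPart N B δ) = lowPart N B δ := by
    ext b
    rw [Finset.mem_filter, and_iff_right_iff_imp]
    exact fun hb => ((mem_lowPart hBN).1 hb).1
  rw [← Finset.sum_filter_add_sum_filter_not B (fun b => b ∈ lowPart N B δ), ← hhigh, hs, hlow,
    Finset.sum_add_distrib, ← add_assoc]
  congr 1
  split_ifs with h0
  · exact (Finset.add_sum_erase _ _ h0).symm
  · rw [Finset.erase_eq_of_notMem h0, zero_add]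

/-- Lower bound for the mask polynomial of a symmetric digit set at points whose `N`-multiple is
close to a half-integer. -/
theorem le_norm_mask_of_symmetric {N : ℕ} {B : Finset ℤ} (hN : 0 < N)
    (hBN : B ⊆ Finset.Ico 0 (N : ℤ)) (hcard : 2 ≤ B.card) {δ : ℝ} (hδ0 : 0 ≤ δ) (hδ : δ < 1 / 2)
    (h : B = nearEnds N B δ) (hs : highPart N B δ = (lowPart N B δ).erase 0) {ε x y : ℝ}
    (hx : ε * (((lowPart N B δ).erase 0).card : ℝ)
      ≤ |∑ b ∈ (lowPart N B δ).erase 0, Real.sin (2 * Real.pi * (b : ℝ) * x)|)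
    (hxy : |y - x| ≤ 1 / (2 * N)) {k : ℤ} {t : ℝ} (hyt : N * y = 1 / 2 + k + t)
    (hε : 2 * Real.pi * (δ + |t|) ≤ ε) : ε / 3 ≤ ‖mask B y‖ := by
  set C := (lowPart N B δ).erase 0
  have hpi := Real.pi_pos
  have hN' : (0 : ℝ) < N := by exact_mod_cast hN
  have hε0 : 0 ≤ ε := le_trans (by positivity) hε
  -- The extra 1 is the unpaired digit 0. Since `B` has at least two elements, `C` is nonempty and
  -- `#B ≤ 3 #C`, whence the factor `1/3`.
  have hBcard : B.card ≤ 2 * C.card + 1 := by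
    have h1 : ∑ _b ∈ B, 1 = (if 0 ∈ lowPart N B δ then 1 else 0) + ∑ _c ∈ C, (1 + 1) :=
      sum_eq_of_symmetric hBN hδ h hs fun _ => (1 : ℕ)
    rw [Finset.sum_const, Finset.sum_const, smul_eq_mul, smul_eq_mul] at h1
    split_ifs at h1 <;> omega
  have hB3 : (B.card : ℝ) ≤ 3 * C.card := by
    have : B.card ≤ 3 * C.card := by omega
    exact_mod_cast this
  have hBpos : (0 : ℝ) < B.card := by exact_mod_cast (by omega : 0 < B.card)
  have hC : ∀ c ∈ C, |(c : ℝ)| ≤ N * δ := by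
    intro c hc
    have h1 := (mem_lowPart hBN).1 (Finset.mem_of_mem_erase hc)
    rw [abs_of_nonneg (by exact_mod_cast (Finset.mem_Ico.1 (hBN h1.1)).1)]
    exact h1.2
  have hsin : (ε - Real.pi * δ) * C.card
      ≤ |∑ c ∈ C, Real.sin (2 * Real.pi * (c : ℝ) * y)| := by
    have h1 : |∑ c ∈ C, Real.sin (2 * Real.pi * (c : ℝ) * x)
        - ∑ c ∈ C, Real.sin (2 * Real.pi * (c : ℝ) * y)| ≤ C.card * (Real.pi * δ) := by
      rw [← Finset.sum_sub_distrib, ← nsmul_eq_mul, ← Finset.sum_const]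
      refine (Finset.abs_sum_le_sum_abs _ _).trans (Finset.sum_le_sum fun c hc => ?_)
      refine (Real.abs_sin_sub_sin_le _ _).trans ?_
      rw [← mul_sub, abs_mul, abs_mul, abs_of_pos (by positivity : 0 < 2 * Real.pi), abs_sub_comm]
      calc 2 * Real.pi * |(c : ℝ)| * |y - x| ≤ 2 * Real.pi * (N * δ) * (1 / (2 * N)) := by
            gcongr; exact hC c hc
        _ = Real.pi * δ := by field_simp
    have h2 := abs_sub_abs_le_abs_sub (∑ c ∈ C, Real.sin (2 * Real.pi * (c : ℝ) * x))
      (∑ c ∈ C, Real.sin (2 * Real.pi * (c : ℝ) * y))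
    linarith
  -- As `N y = 1/2 + k + t`, the reflected digit gives `-expo t * expo (-(c * y))`; replacing `expo
  -- t` by 1 leaves the sine.
  have hterm : ∀ c : ℤ, expo (c * y) + expo (((N - c : ℤ) : ℝ) * y)
      = ((2 * Real.sin (2 * Real.pi * (c : ℝ) * y) : ℝ) : ℂ) * Complex.I
        + (1 - expo t) * expo (-(c * y)) := by
    intro c
    have e1 : ((N - c : ℤ) : ℝ) * y = 1 / 2 + k + t + -(c * y) := by
      rw [← hyt]; push_cast; ring
    have e2 : expo (1 / 2) = -1 := by
      rw [expo, ← Complex.exp_pi_mul_I]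
      push_cast; ring_nf
    have e3 : expo (c * y) - expo (-(c * y))
        = ((2 * Real.sin (2 * Real.pi * (c : ℝ) * y) : ℝ) : ℂ) * Complex.I := by
      apply Complex.ext
      · rw [Complex.sub_re, expo_re, expo_re, Complex.re_ofReal_mul, Complex.I_re, mul_neg,
          Real.cos_neg, sub_self, mul_zero]
      · rw [Complex.sub_im, expo_im, expo_im, Complex.im_ofReal_mul, Complex.I_im, mul_neg,
          Real.sin_neg, mul_assoc (2 * Real.pi)]
        ring
    rw [e1, expo_add, expo_add, expo_add, expo_int, e2, ← e3]
    ring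
  have hsum : ∑ b ∈ B, expo (b * y) = (if 0 ∈ lowPart N B δ then (1 : ℂ) else 0)
      + ((2 * ∑ c ∈ C, Real.sin (2 * Real.pi * (c : ℝ) * y) : ℝ) : ℂ) * Complex.I
      + ∑ c ∈ C, (1 - expo t) * expo (-(c * y)) := by
    rw [sum_eq_of_symmetric hBN hδ h hs fun b => expo (b * y), add_assoc]
    congr 1
    · simp [expo_zero]
    · rw [Finset.sum_congr rfl fun c _ => hterm c, Finset.sum_add_distrib, ← Finset.sum_mul,
        Finset.mul_sum, Complex.ofReal_sum]
  have herr : ‖∑ c ∈ C, (1 - expo t) * expo (-(c * y))‖ ≤ C.card * (2 * Real.pi * |t|) := by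
    rw [← nsmul_eq_mul, ← Finset.sum_const]
    refine norm_sum_le_of_le _ fun c _ => ?_
    rw [norm_mul, norm_expo, mul_one, norm_sub_rev]
    exact norm_expo_sub_one_le t
  -- The digit 0 contributes a real number and the sines an imaginary one, so they cannot cancel.
  have him : |2 * ∑ c ∈ C, Real.sin (2 * Real.pi * (c : ℝ) * y)|
      - C.card * (2 * Real.pi * |t|) ≤ ‖∑ b ∈ B, expo (b * y)‖ := by
    have h1 := Complex.abs_im_le_norm ((if 0 ∈ lowPart N B δ then (1 : ℂ) else 0)
      + ((2 * ∑ c ∈ C, Real.sin (2 * Real.pi * (c : ℝ) * y) : ℝ) : ℂ) * Complex.I)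
    have h2 : ((if 0 ∈ lowPart N B δ then (1 : ℂ) else 0)
      + ((2 * ∑ c ∈ C, Real.sin (2 * Real.pi * (c : ℝ) * y) : ℝ) : ℂ) * Complex.I).im
      = 2 * ∑ c ∈ C, Real.sin (2 * Real.pi * (c : ℝ) * y) := by
      rw [Complex.add_im, Complex.im_ofReal_mul, Complex.I_im, mul_one]
      split_ifs <;> simp
    rw [h2] at h1
    rw [hsum]
    have h3 := norm_sub_le_norm_add ((if 0 ∈ lowPart N B δ then (1 : ℂ) else 0)
      + ((2 * ∑ c ∈ C, Real.sin (2 * Real.pi * (c : ℝ) * y) : ℝ) : ℂ) * Complex.I)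
      (∑ c ∈ C, (1 - expo t) * expo (-(c * y)))
    linarith
  rw [abs_mul, abs_two] at him
  -- Per element of `C` the bound is `2(ε - πδ) - 2π|t| = 2ε - 2π(δ + |t|) ≥ ε`.
  have hfin : ε * C.card ≤ ‖∑ b ∈ B, expo (b * y)‖ := by
    have h1 := mul_le_mul_of_nonneg_right hε (Nat.cast_nonneg (α := ℝ) C.card)
    linarith
  rw [mask, norm_mul, norm_inv, Complex.norm_natCast, inv_mul_eq_div, le_div_iff₀ hBpos]
  nlinarith

/-! ### Uniform positivity of the tails. -/

/-- Under the hypotheses on the sums of sines, infinitely many of the tails have Fourier transforms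
uniformly bounded away from zero on some integer translate of each point. -/
theorem exists_frequently_le_norm_cf_nuTail {N : ℕ → ℕ} {B : ℕ → Finset ℤ} (hN : ∀ n, 2 ≤ N n)
    (hB : ∀ n, (B n).Nonempty) (hBN : ∀ n, B n ⊆ Finset.Ico 0 (N n : ℤ))
    (hcardN : ∀ n, (B n).card ≤ N n) (hweak : WeaklyConverges (nuTail N B) rho)
    (hcard : Tendsto (fun n => (B n).card) atTop atTop) (hsymm : IsSymmetric N B)
    {δ : ℝ} (hδ0 : 0 < δ) (hδ : δ < 1 / 2) {n : ℕ → ℕ} (hn : StrictMono n)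
    (hsine : SumOfSineHolds (Set.range fun j => (lowPart (N (n j)) (B (n j)) δ).erase 0)) :
    ∃ ε > 0, ∃ᶠ m in atTop, ∀ x : ℝ, ∃ k : ℤ, ε ≤ ‖cf (nuTail N B m) (x + k)‖ := by
  obtain ⟨ε₀, hε₀, δ₀, hδ₀, hsine⟩ := hsine
  obtain ⟨δ₁, hδ₁, hsymm⟩ := hsymm
  have hpi := Real.pi_pos
  have hprob := isProbabilityMeasure_nuTail hN hB hBN
  -- With `δ' ≤ η` and distance to the half-integer at most `η`, the total error `2π(δ' + |t|)` is
  -- at most `4πη = ε₀`.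
  set η := ε₀ / (4 * Real.pi) with hη
  have hη0 : 0 < η := by positivity
  set δ' := min δ (min (δ₁ / 2) η)
  have hδ'0 : 0 < δ' := by positivity
  have hδ'δ : δ' ≤ δ := min_le_left _ _
  have hδ'1 : δ' ≤ δ₁ / 2 := (min_le_right _ _).trans (min_le_left _ _)
  have hδ'η : δ' ≤ η := (min_le_right _ _).trans (min_le_right _ _)
  have hη4 : 4 * Real.pi * η = ε₀ := by rw [hη]; field_simp
  obtain ⟨n₀, hn₀⟩ := hsymm δ' hδ'0 (by linarith)
  have hunif : ∀ {e : ℝ}, 0 < e → ∀ᶠ m in atTop, ∀ x ∈ Set.Icc (0 : ℝ) 1,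
      ‖cf (nuTail N B m) x - cf rho x‖ ≤ e := fun he =>
    eventually_forall_norm_sub_le_of_lipschitz (by positivity)
      (norm_cf_nuTail_sub_le hN hB hBN) hweak.tendsto_cf he
  have hNlarge : ∀ᶠ m in atTop, Real.pi / N m ≤ δ₀ / 2 := by
    have h1 : Tendsto (fun m => (N m : ℝ)) atTop atTop :=
      tendsto_natCast_atTop_atTop.comp (tendsto_atTop_mono hcardN hcard)
    exact (tendsto_const_nhds.div_atTop h1).eventually_le_const (half_pos hδ₀)
  have hev := ((((eventually_ge_atTop n₀).and (hcard.eventually_ge_atTop 2)).and hNlarge).and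
    (hunif hη0)).and ((tendsto_add_atTop_nat 1).eventually (hunif (half_pos hδ₀)))
  refine ⟨min η (ε₀ / 3 * δ₀), by positivity, hn.tendsto_atTop.frequently
    ((hn.tendsto_atTop.eventually hev).mono fun j hj => ?_).frequently⟩
  obtain ⟨⟨⟨⟨hjn₀, hjcard⟩, hjN⟩, hF⟩, hF1⟩ := hj
  obtain ⟨x₀, ⟨hx₀0, hx₀1⟩, hx₀⟩ := hsine _ ⟨j, rfl⟩
  set m := n j
  obtain ⟨hnear, hhigh⟩ := hn₀ m hjn₀
  have hNpos : 0 < N m := by have := hN m; omega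
  have hNpos' : (0 : ℝ) < N m := by exact_mod_cast hNpos
  intro x
  have hfr := Int.fract_add_floor x
  have hr0 := Int.fract_nonneg x
  have hr1 := (Int.fract_lt_one x).le
  set r := Int.fract x
  -- Away from `1/2` the limit transform exceeds `2η`, and the uniform error `η` leaves `η`.
  by_cases hr : η < |r - 1 / 2|
  · refine ⟨-⌊x⌋, (min_le_left _ _).trans ?_⟩
    rw [show x + ((-⌊x⌋ : ℤ) : ℝ) = r by push_cast; linarith]
    have h1 := abs_one_sub_two_mul_le_norm_cf_rho hr0 hr1
    have h2 := hF r ⟨hr0, hr1⟩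
    rw [norm_sub_rev] at h2
    have h3 := norm_sub_norm_le (cf rho r) (cf (nuTail N B m) r)
    have h4 : |1 - 2 * r| = 2 * |r - 1 / 2| := by
      rw [← abs_neg, show -(1 - 2 * r) = 2 * (r - 1 / 2) by ring, abs_mul, abs_two]
    linarith
  · rw [not_lt] at hr
    -- This translate makes `(r + q) / N m` the point of its class nearest to `x₀`.
    set q := round (N m * x₀ - r)
    refine ⟨q - ⌊x⌋, (min_le_right _ _).trans ?_⟩
    rw [show x + ((q - ⌊x⌋ : ℤ) : ℝ) = r + q by push_cast; linarith,
      cf_nuTail_eq_mask_mul hN hB hBN, norm_mul]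
    set y := (r + q) / N m
    have hNy : N m * y = r + q := mul_div_cancel₀ _ hNpos'.ne'
    have hxy : |y - x₀| ≤ 1 / (2 * N m) := by
      have h1 := abs_sub_round (N m * x₀ - r)
      have h2 : y - x₀ = -((N m * x₀ - r - q) / N m) := by
        rw [eq_neg_iff_add_eq_zero]; simp only [y]; field_simp; ring
      rw [h2, abs_neg, abs_div, abs_of_pos hNpos', div_le_iff₀ hNpos']
      refine h1.trans (le_of_eq ?_)
      field_simp
    have hmask : ε₀ / 3 ≤ ‖mask (B m) y‖ := by
      have hδlow := lowPart_eq_of_eq_nearEnds (hBN m) hδ'δ hδ hnear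
      refine le_norm_mask_of_symmetric hNpos (hBN m) hjcard hδ'0.le (hδ'δ.trans_lt hδ) hnear hhigh
        (by rw [← hδlow]; exact hx₀) hxy (k := q) (t := r - 1 / 2) (by rw [hNy]; ring) ?_
      rw [← hη4]
      nlinarith
    -- At `x₀ ≤ 1/2 - δ₀` the limit transform is at least `2δ₀`; weak convergence and the move from
    -- `x₀` to `y` cost `δ₀ / 2` each.
    have htail : δ₀ ≤ ‖cf (nuTail N B (m + 1)) y‖ := by
      have h1 := abs_one_sub_two_mul_le_norm_cf_rho hx₀0 (by linarith)
      have h2 := hF1 x₀ ⟨hx₀0, by linarith⟩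
      have h3 := norm_cf_nuTail_sub_le hN hB hBN (m + 1) y x₀
      have h4 : 2 * Real.pi * |y - x₀| ≤ δ₀ / 2 := by
        calc 2 * Real.pi * |y - x₀| ≤ 2 * Real.pi * (1 / (2 * N m)) := by gcongr
          _ = Real.pi / N m := by field_simp
          _ ≤ _ := hjN
      rw [norm_sub_rev] at h2 h3
      have h5 := norm_sub_norm_le (cf rho x₀) (cf (nuTail N B (m + 1)) x₀)
      have h6 := norm_sub_norm_le (cf (nuTail N B (m + 1)) x₀) (cf (nuTail N B (m + 1)) y)
      have h7 := le_abs_self (1 - 2 * x₀)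
      linarith
    gcongr

end CantorMoran

end

theorem theorem1p6 (N : ℕ → ℕ) (B L : ℕ → Finset ℤ)
    (hHad : ∀ n, CantorMoran.IsHadamardTriple (N n) (B n) (L n))
    (hBN : ∀ n, B n ⊆ Finset.Ico 0 (N n : ℤ))
    (hweak : CantorMoran.WeaklyConverges (CantorMoran.nuTail N B) CantorMoran.rho)
    (hcard : Tendsto (fun n => (B n).card) atTop atTop)
    (hsymm : CantorMoran.IsSymmetric N B)
    (δ : ℝ) (hδ0 : 0 < δ) (hδ1 : δ < 1 / 3)
    (n : ℕ → ℕ) (hn : StrictMono n)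
    (hsine : CantorMoran.SumOfSineHolds
      (Set.range fun j => (CantorMoran.lowPart (N (n j)) (B (n j)) δ).erase 0)) :
    CantorMoran.IsSpectralMeasure (CantorMoran.cantorMoran N B) := by
  have hN := fun n => (hHad n).two_le
  have hB := fun n => (hHad n).nonempty
  obtain ⟨ε, hε, hpos⟩ := CantorMoran.exists_frequently_le_norm_cf_nuTail hN hB hBN
    (fun n => (hHad n).card_le) hweak hcard hsymm hδ0 (by linarith) hn hsine
  obtain ⟨S, hS⟩ := CantorMoran.exists_hasSum_norm_cf_sq hHad hBN (ε := min ε (1 / 2))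
    (by positivity) (min_le_right _ _)
    (hpos.mono fun m hm x => (hm x).imp fun k hk => (min_le_left _ _).trans hk)
  have : IsProbabilityMeasure (CantorMoran.cantorMoran N B) := by
    simpa [CantorMoran.tailMeasure, CantorMoran.cantorMoran] using
      CantorMoran.isProbabilityMeasure_tailMeasure hN hB hBN 0
  -- The sums obtained run over `ξ + l`, while the basis criterion uses `ξ - l`, so the spectrum is
  -- `-S`.
  let φ : ℤ → ℝ := fun l => -(l : ℝ)
  have hφ : Function.Injective φ := fun a b hab => by exact_mod_cast neg_injective hab
  refine CantorMoran.isSpectralMeasure_of_hasSum (Λ := φ '' S) (S.to_countable.image φ)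
    fun ξ => ?_
  rw [← (Equiv.Set.image φ S hφ).hasSum_iff]
  exact (hS ξ).congr_fun fun l => by simp [φ]
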